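/- Theorem 3. Call an algorithm whose input is a rational \(n\times n\) matrix \(H\) *strongly polynomial* if it uses polynomial space in the bit model (throughout the execution, the total number of bits needed to store its memory is bounded by a polynomial in the size of \(H\), i.e. the total binary encoding length of the entries of \(H\)) and polynomial time in the arithmetic model (the number of its elementary steps — arithmetic operations \(+,-,\times,/\) on rational numbers, comparisons, and bookkeeping steps — is bounded by a polynomial in \(n\)). There is a strongly polynomial algorithm that, given any rational symmetric \(n\times n\) matrix \(H\), finds rational \(n\times n\) matrices \(B\) and \(D\) such that \(B\) is nonsingular, \(D\) is diagonal, and \[ B H B^{\mathsf T} = D . \] Furthermore, the matrix \(B\) found by this algorithm satisfies \[ \|B\|_F \le (5n)^{n/2} \quad\text{and}\quad \|B^{-1}\|_F \le (5n)^{n/2}, \] where \(\|A\|_F=\sqrt{\sum_{i,j}A_{ij}^2}\) denotes the Frobenius norm. -/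

import Mathlib

noncomputable section

namespace SymDec

/-! ## Encoding lengths

The size of a rational `p / q` in lowest terms is `1 + ⌈log₂ (|p| + 1)⌉ + ⌈log₂ (q + 1)⌉`
(`Nat.size k` is the number of binary digits of `k`, which is `⌈log₂ (k + 1)⌉`), and the size of a
matrix is the sum of the sizes of its entries. -/

/-- Number of bits needed to write down a rational number. -/
def ratSize (q : ℚ) : ℕ := 1 + q.num.natAbs.size + q.den.size

/-- Number of bits needed to write down a rational matrix. -/
def matSize {n : ℕ} (A : Matrix (Fin n) (Fin n) ℚ) : ℕ := ∑ i, ∑ j, ratSize (A i j)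

/-! ## The machine

A random access machine over `ℚ`. It has index registers, which hold natural numbers and serve
only for addressing and counting, and data registers, which hold rational numbers. Data registers
are arranged in two-dimensional arrays: the one at `(a, i, j)` is the entry `(i, j)` of array `a`.
Every register holds `0` until it is written. No operation turns a data value into an index: data
values influence the run only through the four arithmetic operations and comparisons, and there
is no rounding and no access to digits, numerators or denominators. -/

/-- The memory of the machine. -/
structure Store where
  /-- index registers -/
  idx : ℕ →₀ ℕ
  /-- data registers -/
  num : ℕ × ℕ × ℕ →₀ ℚ

/-- A data operand: array `arr`, row and column given by the contents of the index registers
`row` and `col`. -/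
structure Ref where
  arr : ℕ
  row : ℕ
  col : ℕ

/-- The address of the data register that an operand currently refers to. -/
def Ref.addr (x : Ref) (σ : Store) : ℕ × ℕ × ℕ := (x.arr, σ.idx x.row, σ.idx x.col)

/-- The current value of a data operand. -/
def Ref.val (x : Ref) (σ : Store) : ℚ := σ.num (x.addr σ)

def Store.setIdx (σ : Store) (r v : ℕ) : Store := { σ with idx := σ.idx.update r v }

def Store.setNum (σ : Store) (z : Ref) (q : ℚ) : Store :=
  { σ with num := σ.num.update (z.addr σ) q }

/-- The elementary arithmetic operations on rationals. -/
inductive ArithOp where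
  | add | sub | mul | div

/-- The result of an arithmetic operation; division by zero has none. -/
def ArithOp.eval : ArithOp → ℚ → ℚ → Option ℚ
  | .add, x, y => some (x + y)
  | .sub, x, y => some (x - y)
  | .mul, x, y => some (x * y)
  | .div, x, y => if y = 0 then none else some (x / y)

/-- Comparisons of two index registers or of two data registers. -/
inductive Test where
  | idxLt (a b : ℕ)
  | numLt (x y : Ref)

def Test.eval : Test → Store → Bool
  | .idxLt a b, σ => decide (σ.idx a < σ.idx b)
  | .numLt x y, σ => decide (x.val σ < y.val σ)

/-- Programs. A program is a finite object; it does not depend on the input. -/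
inductive Prog where
  /-- do nothing -/
  | skip
  /-- index register `r` becomes the constant `c` -/
  | idxConst (r c : ℕ)
  /-- index register `r` becomes the sum of index registers `a` and `b` -/
  | idxAdd (r a b : ℕ)
  /-- index register `r` becomes the (truncated) difference of index registers `a` and `b` -/
  | idxSub (r a b : ℕ)
  /-- data register `z` becomes the constant `q` -/
  | numConst (z : Ref) (q : ℚ)
  /-- data register `z` becomes the result of an arithmetic operation on `x` and `y` -/
  | arith (o : ArithOp) (z x y : Ref)
  | seq (p q : Prog)
  | ite (t : Test) (p q : Prog)
  | loop (t : Test) (p : Prog)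

/-- A configuration: what remains to be executed, and the memory. The first component consists of
pieces of the program, and its length is bounded by a constant that depends only on the program. -/
structure Config where
  control : List Prog
  store : Store

/-- One step: one assignment, one arithmetic operation, or one test. A division by zero blocks the
machine: it stays in the same configuration for ever, and so does not halt. -/
def step : Config → Config
  | ⟨[], σ⟩ => ⟨[], σ⟩
  | ⟨.skip :: K, σ⟩ => ⟨K, σ⟩
  | ⟨.idxConst r c :: K, σ⟩ => ⟨K, σ.setIdx r c⟩
  | ⟨.idxAdd r a b :: K, σ⟩ => ⟨K, σ.setIdx r (σ.idx a + σ.idx b)⟩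
  | ⟨.idxSub r a b :: K, σ⟩ => ⟨K, σ.setIdx r (σ.idx a - σ.idx b)⟩
  | ⟨.numConst z q :: K, σ⟩ => ⟨K, σ.setNum z q⟩
  | ⟨.arith o z x y :: K, σ⟩ =>
      match o.eval (x.val σ) (y.val σ) with
      | some q => ⟨K, σ.setNum z q⟩
      | none => ⟨.arith o z x y :: K, σ⟩
  | ⟨.seq p q :: K, σ⟩ => ⟨p :: q :: K, σ⟩
  | ⟨.ite t p q :: K, σ⟩ => ⟨(if t.eval σ then p else q) :: K, σ⟩
  | ⟨.loop t p :: K, σ⟩ => ⟨if t.eval σ then p :: .loop t p :: K else K, σ⟩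

/-- The configuration reached from memory `σ` after `t` steps of the program `P`. -/
def Prog.run (P : Prog) (σ : Store) (t : ℕ) : Config := step^[t] ⟨[P], σ⟩

/-- The program has come to its end after at most `t` steps. -/
def Prog.HaltsBy (P : Prog) (σ : Store) (t : ℕ) : Prop := (P.run σ t).control = []

/-- The number of bits needed to write the memory down: the binary addresses and the binary
contents of all registers that are not zero. -/
def Store.space (σ : Store) : ℕ :=
  (σ.idx.sum fun r v => r.size + v.size) +
    σ.num.sum fun c q => c.1.size + c.2.1.size + c.2.2.size + ratSize q

/-! ## Input, output, strong polynomiality -/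

/-- The memory at the start: index register `0` holds the dimension `n`, array `0` holds the
matrix `H`, and all other registers are zero. -/
def inputStore {n : ℕ} (H : Matrix (Fin n) (Fin n) ℚ) : Store where
  idx := Finsupp.single 0 n
  num := ∑ i : Fin n, ∑ j : Fin n, Finsupp.single (0, (i : ℕ), (j : ℕ)) (H i j)

/-- The `n × n` matrix that array `a` holds. -/
def Store.matrix (σ : Store) (a n : ℕ) : Matrix (Fin n) (Fin n) ℚ :=
  Matrix.of fun i j => σ.num (a, (i : ℕ), (j : ℕ))

theorem inputStore_matrix {n : ℕ} (H : Matrix (Fin n) (Fin n) ℚ) :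
    (inputStore H).matrix 0 n = H := by
  ext i j
  simp only [Store.matrix, inputStore, Matrix.of_apply, Finsupp.finsetSum_apply,
    Finsupp.single_apply, Prod.mk.injEq, true_and]
  rw [Finset.sum_eq_single i, Finset.sum_eq_single j]
  · simp
  · intro b _ hb
    simp [Fin.val_inj, hb]
  · simp
  · intro b _ hb
    simp [Fin.val_inj, hb]
  · simp

/-- On input `H` the program halts with `B` in array `1` and `D` in array `2`. -/
def Prog.Outputs (P : Prog) {n : ℕ} (H B D : Matrix (Fin n) (Fin n) ℚ) : Prop :=
  ∃ t, P.HaltsBy (inputStore H) t ∧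
    (P.run (inputStore H) t).store.matrix 1 n = B ∧
    (P.run (inputStore H) t).store.matrix 2 n = D

/-- Polynomial time in the arithmetic model, on the inputs in `A`: every operation on numbers counts
as one step, and the number of steps is bounded by a polynomial in the dimension of the input. -/
def Prog.PolyTimeArithmeticOn (P : Prog) (A : ∀ n, Set (Matrix (Fin n) (Fin n) ℚ)) : Prop :=
  ∃ T : Polynomial ℕ, ∀ n, ∀ H ∈ A n, P.HaltsBy (inputStore H) (T.eval n)

/-- Polynomial space in the bit model, on the inputs in `A`: at every moment of the run, the whole
memory, written in binary, has a length that is bounded by a polynomial in the size of the input. -/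
def Prog.PolySpaceOn (P : Prog) (A : ∀ n, Set (Matrix (Fin n) (Fin n) ℚ)) : Prop :=
  ∃ S : Polynomial ℕ, ∀ n, ∀ H ∈ A n, ∀ t,
    (P.run (inputStore H) t).store.space ≤ S.eval (matSize H)

/-- A strongly polynomial algorithm: polynomial space when numbers are written in binary, and
polynomial time in the arithmetic model. -/
def Prog.StronglyPolynomialOn (P : Prog) (A : ∀ n, Set (Matrix (Fin n) (Fin n) ℚ)) : Prop :=
  P.PolySpaceOn A ∧ P.PolyTimeArithmeticOn A

/-! ## Symmetric decompositions -/

/-- `B H Bᵀ = D` with `B` nonsingular and `D` diagonal. -/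
structure IsSymmetricDecomposition {n : ℕ} (H B D : Matrix (Fin n) (Fin n) ℚ) : Prop where
  nonsingular : IsUnit B.det
  diagonal : D.IsDiag
  eq : B * H * B.transpose = D

/-- The Frobenius norm of a rational matrix. -/
def frobeniusNorm {n : ℕ} (A : Matrix (Fin n) (Fin n) ℚ) : ℝ :=
  Real.sqrt (∑ i, ∑ j, (A i j : ℝ) ^ 2)

end SymDec

end

/-!
The algorithm stores only the transformation `B`, initially the identity, and recomputes
`A = B * H * Bᵀ` after every change of `B`. As long as `A` is not diagonal it takes the largest
off-diagonal entry `A i j`. If `A i i` is at least as large in absolute value, it is the pivot.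
Otherwise row `j` is first added to or subtracted from row `i`, with the sign for which the new
diagonal entry `(A i i + A j j) ± 2 * A i j` has absolute value `|A i i + A j j| + 2 * |A i j|`. In
both cases the pivot is at least as large as every other entry of its row
(`IsPivotChoice.dominates`), so all elimination multipliers have absolute value at most `1`.
A row whose pivot has been used has no nonzero off-diagonal entry any more and is never touched again
(`IsPivoted.notMem_of_ne_zero`), so there are fewer than `n` passes.

**Norms.** A pass multiplies `B` from the left by a matrix each of whose rows, and of those of its
inverse, has sum of squares at most `5` (`IsPivotChoice.exists_rowOp`). By submultiplicativity of the
Frobenius norm the squared norms of `B` and `B⁻¹` are at most `n * (5 * n) ^ (n - 1)`.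

**Lengths.** Row additions commute past earlier eliminations. Hence the rows of `B` that have not
served as pivots are rows of an integer matrix `U` with entries at most `2 ^ n`, made orthogonal, with
respect to the form `H`, to the rows `U t` for the used pivots `t` (`IsPivoted`). The coefficients
solve a linear system whose matrix consists, up to a common denominator of `H`, of entries of
`U * H * Uᵀ`, and Cramer's rule gives a common denominator of polynomial length for these rows
(`IsPivoted.exists_denominator`). Together with the bound for the norm this bounds the numerators
too. All other numbers that occur are obtained from the entries of `B` and `H` by sums of `n` terms
and a bounded number of arithmetic operations, and such operations increase lengths by a polynomial
factor only.

**The machine.** `Prog.Ensures` is a total-correctness statement for programs all of whose loops make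
at most `n` passes. It includes the number of steps (`Prog.cost`, visibly a polynomial in `n`), a
bound for all memories during the run (`Store.Ready`) and a frame property (`Prog.Agree`).
-/

namespace SymDec

/-! ### Heights of rational numbers -/

/-- `HeightLE s q`: numerator and denominator of `q` are at most `2 ^ s` in absolute value. -/
def HeightLE (s : ℕ) (q : ℚ) : Prop := q.num.natAbs ≤ 2 ^ s ∧ q.den ≤ 2 ^ s

theorem HeightLE.of_eq_div {s : ℕ} {q : ℚ} {a b : ℤ} (hb : b ≠ 0) (h : q = a / b)
    (ha : a.natAbs ≤ 2 ^ s) (hb' : b.natAbs ≤ 2 ^ s) : HeightLE s q := by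
  rw [← Rat.divInt_eq_div] at h
  subst h
  constructor
  · rcases eq_or_ne a 0 with rfl | ha0
    · simp
    · exact (Nat.le_of_dvd (Int.natAbs_pos.2 ha0)
        (Int.natAbs_dvd_natAbs.2 (Rat.num_dvd a hb))).trans ha
  · exact (Nat.le_of_dvd (Int.natAbs_pos.2 hb)
      (Int.natCast_dvd.1 (Rat.den_dvd a b))).trans hb'

theorem HeightLE.mono {s t : ℕ} {q : ℚ} (h : HeightLE s q) (hst : s ≤ t) : HeightLE t q :=
  ⟨h.1.trans (Nat.pow_le_pow_right two_pos hst), h.2.trans (Nat.pow_le_pow_right two_pos hst)⟩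

theorem HeightLE.zero (s : ℕ) : HeightLE s 0 := ⟨by simp, by simpa using Nat.one_le_two_pow⟩

theorem HeightLE.one (s : ℕ) : HeightLE s 1 :=
  ⟨by simpa using Nat.one_le_two_pow, by simpa using Nat.one_le_two_pow⟩

theorem HeightLE.neg {s : ℕ} {q : ℚ} (h : HeightLE s q) : HeightLE s (-q) := by
  simpa [HeightLE] using h

theorem HeightLE.add {s t : ℕ} {x y : ℚ} (hx : HeightLE s x) (hy : HeightLE t y) :
    HeightLE (s + t + 1) (x + y) := by
  have hxd : (x.den : ℚ) ≠ 0 := by simp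
  have hyd : (y.den : ℚ) ≠ 0 := by simp
  refine .of_eq_div (a := x.num * y.den + y.num * x.den) (b := x.den * y.den) (by simp) ?_ ?_ ?_
  · push_cast
    rw [add_div, mul_div_mul_right _ _ hyd, mul_comm (x.den : ℚ), mul_div_mul_right _ _ hxd,
      Rat.num_div_den, Rat.num_div_den]
  · refine (Int.natAbs_add_le _ _).trans ?_
    rw [Int.natAbs_mul, Int.natAbs_mul, Int.natAbs_natCast, Int.natAbs_natCast]
    have h1 := Nat.mul_le_mul hx.1 hy.2
    have h2 := Nat.mul_le_mul hy.1 hx.2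
    rw [pow_succ, pow_add]
    linarith
  · rw [Int.natAbs_mul, Int.natAbs_natCast, Int.natAbs_natCast, pow_succ, pow_add]
    have := Nat.mul_le_mul hx.2 hy.2
    omega

theorem HeightLE.sub {s t : ℕ} {x y : ℚ} (hx : HeightLE s x) (hy : HeightLE t y) :
    HeightLE (s + t + 1) (x - y) := sub_eq_add_neg x y ▸ hx.add hy.neg

theorem HeightLE.mul {s t : ℕ} {x y : ℚ} (hx : HeightLE s x) (hy : HeightLE t y) :
    HeightLE (s + t) (x * y) := by
  refine .of_eq_div (a := x.num * y.num) (b := x.den * y.den) (by simp) ?_ ?_ ?_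
  · push_cast
    rw [mul_div_mul_comm, Rat.num_div_den, Rat.num_div_den]
  · rw [Int.natAbs_mul, pow_add]
    exact Nat.mul_le_mul hx.1 hy.1
  · rw [Int.natAbs_mul, Int.natAbs_natCast, Int.natAbs_natCast, pow_add]
    exact Nat.mul_le_mul hx.2 hy.2

theorem HeightLE.div {s t : ℕ} {x y : ℚ} (hx : HeightLE s x) (hy : HeightLE t y) :
    HeightLE (s + t) (x / y) := by
  rcases eq_or_ne y 0 with rfl | hy0
  · simpa using HeightLE.zero _
  refine .of_eq_div (a := x.num * y.den) (b := x.den * y.num) (by simpa using hy0) ?_ ?_ ?_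
  · push_cast
    rw [mul_div_mul_comm, Rat.num_div_den, ← inv_div (y.num : ℚ), Rat.num_div_den, div_eq_mul_inv]
  · rw [Int.natAbs_mul, Int.natAbs_natCast, pow_add]
    exact Nat.mul_le_mul hx.1 hy.2
  · rw [Int.natAbs_mul, Int.natAbs_natCast, pow_add]
    exact Nat.mul_le_mul hx.2 hy.1

theorem HeightLE.sum_range {s : ℕ} {f : ℕ → ℚ} (k : ℕ) (h : ∀ i < k, HeightLE s (f i)) :
    HeightLE (k * (s + 1)) (∑ i ∈ Finset.range k, f i) := by
  induction k with
  | zero => simpa using HeightLE.zero _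
  | succ k ih =>
    rw [Finset.sum_range_succ]
    refine ((ih fun i hi => h i (by omega)).add (h k (by omega))).mono (le_of_eq ?_)
    ring

theorem HeightLE.ratSize_le {s : ℕ} {q : ℚ} (h : HeightLE s q) : ratSize q ≤ 2 * s + 3 := by
  have h2 : 2 ^ s < 2 ^ (s + 1) := Nat.pow_lt_pow_right (by norm_num) (by omega)
  have h3 := Nat.size_le.2 (h.1.trans_lt h2)
  have h4 := Nat.size_le.2 (h.2.trans_lt h2)
  unfold ratSize
  omega

theorem HeightLE.of_ratSize_le {s : ℕ} {q : ℚ} (h : ratSize q ≤ s) : HeightLE s q := by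
  unfold ratSize at h
  exact ⟨(Nat.size_le.1 (by omega)).le, (Nat.size_le.1 (by omega)).le⟩

/-! ### Cost and frame of a program -/

/-- The number of steps of a program all of whose loops make at most `n` passes. -/
def Prog.cost (n : ℕ) : Prog → ℕ
  | .seq p q => p.cost n + q.cost n + 1
  | .ite _ p q => p.cost n + q.cost n + 1
  | .loop _ p => n * (p.cost n + 1) + 1
  | _ => 1

theorem Prog.exists_polynomial_cost (P : Prog) :
    ∃ T : Polynomial ℕ, ∀ n, T.eval n = P.cost n := by
  induction P with
  | seq p q hp hq =>
    obtain ⟨T, hT⟩ := hp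
    obtain ⟨R, hR⟩ := hq
    exact ⟨T + R + 1, fun n => by simp [cost, hT, hR]⟩
  | ite t p q hp hq =>
    obtain ⟨T, hT⟩ := hp
    obtain ⟨R, hR⟩ := hq
    exact ⟨T + R + 1, fun n => by simp [cost, hT, hR]⟩
  | loop t p hp =>
    obtain ⟨T, hT⟩ := hp
    exact ⟨.X * (T + 1) + 1, fun n => by simp [cost, hT]⟩
  | _ => exact ⟨1, fun n => by simp [cost]⟩

/-- The index registers that a program may write. -/
def Prog.modIdx : Prog → List ℕ
  | .idxConst r _ => [r]
  | .idxAdd r _ _ => [r]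
  | .idxSub r _ _ => [r]
  | .seq p q => p.modIdx ++ q.modIdx
  | .ite _ p q => p.modIdx ++ q.modIdx
  | .loop _ p => p.modIdx
  | _ => []

/-- The arrays that a program may write. -/
def Prog.modArr : Prog → List ℕ
  | .numConst z _ => [z.arr]
  | .arith _ z _ _ => [z.arr]
  | .seq p q => p.modArr ++ q.modArr
  | .ite _ p q => p.modArr ++ q.modArr
  | .loop _ p => p.modArr
  | _ => []

/-- `P.Agree σ τ`: the memories `σ` and `τ` coincide outside what `P` may write. -/
structure Prog.Agree (P : Prog) (σ τ : Store) : Prop where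
  idx : ∀ r ∉ P.modIdx, τ.idx r = σ.idx r
  num : ∀ a ∉ P.modArr, ∀ i j, τ.num (a, i, j) = σ.num (a, i, j)

theorem Prog.Agree.refl (P : Prog) (σ : Store) : P.Agree σ σ := ⟨fun _ _ => rfl, fun _ _ _ _ => rfl⟩

theorem Prog.Agree.trans {P : Prog} {σ τ ρ : Store} (h : P.Agree σ τ) (h' : P.Agree τ ρ) :
    P.Agree σ ρ :=
  ⟨fun r hr => (h'.idx r hr).trans (h.idx r hr),
    fun a ha i j => (h'.num a ha i j).trans (h.num a ha i j)⟩

theorem Prog.Agree.mono {P Q : Prog} {σ τ : Store} (h : P.Agree σ τ)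
    (hI : P.modIdx ⊆ Q.modIdx) (hA : P.modArr ⊆ Q.modArr) : Q.Agree σ τ :=
  ⟨fun r hr => h.idx r fun h' => hr (hI h'), fun a ha => h.num a fun h' => ha (hA h')⟩

@[simp] theorem Store.setIdx_num (σ : Store) (r v : ℕ) : (σ.setIdx r v).num = σ.num := rfl

@[simp] theorem Store.setNum_idx (σ : Store) (z : Ref) (q : ℚ) : (σ.setNum z q).idx = σ.idx := rfl

@[simp] theorem Store.setIdx_idx (σ : Store) (r v s : ℕ) :
    (σ.setIdx r v).idx s = if s = r then v else σ.idx s := by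
  simp [setIdx, Finsupp.update_apply]

theorem Store.setNum_num (σ : Store) (z : Ref) (q : ℚ) (c : ℕ × ℕ × ℕ) :
    (σ.setNum z q).num c = if c = z.addr σ then q else σ.num c := by
  simp [setNum, Finsupp.update_apply]

/-! ### Bounded memories -/

/-- A memory that is in use by a program with index registers `0, …, 6` and arrays `0, …, 8`, on an
input of dimension `n`, and whose data registers have height at most `S`. -/
structure Store.Bounded (n S : ℕ) (σ : Store) : Prop where
  idx_eq_zero : ∀ r, 7 ≤ r → σ.idx r = 0
  idx_le : ∀ r, σ.idx r ≤ n + 1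
  arr_eq_zero : ∀ a i j, 9 ≤ a → σ.num (a, i, j) = 0
  row_eq_zero : ∀ a i j, n + 1 < i → σ.num (a, i, j) = 0
  col_eq_zero : ∀ a i j, n + 1 < j → σ.num (a, i, j) = 0
  height : ∀ c, HeightLE S (σ.num c)

/-- A bounded memory in which index register `0` holds the dimension and index register `1` holds
the constant `1`. -/
structure Store.Ready (n S : ℕ) (σ : Store) : Prop extends σ.Bounded n S where
  dim : σ.idx 0 = n
  one : σ.idx 1 = 1

theorem Store.Bounded.setIdx {n S : ℕ} {σ : Store} (h : σ.Bounded n S) {r v : ℕ} (hr : r < 7)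
    (hv : v ≤ n + 1) : (σ.setIdx r v).Bounded n S where
  idx_eq_zero s hs := by
    rw [setIdx_idx, if_neg (by omega), h.idx_eq_zero s hs]
  idx_le s := by
    rw [setIdx_idx]
    split_ifs
    exacts [hv, h.idx_le s]
  arr_eq_zero := h.arr_eq_zero
  row_eq_zero := h.row_eq_zero
  col_eq_zero := h.col_eq_zero
  height := h.height

theorem Store.Ready.setIdx {n S : ℕ} {σ : Store} (h : σ.Ready n S) {r v : ℕ} (hr : r < 7)
    (hr' : 1 < r) (hv : v ≤ n + 1) : (σ.setIdx r v).Ready n S where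
  toBounded := h.toBounded.setIdx hr hv
  dim := by rw [setIdx_idx, if_neg (by omega), h.dim]
  one := by rw [setIdx_idx, if_neg (by omega), h.one]

theorem Store.Ready.setNum {n S : ℕ} {σ : Store} (h : σ.Ready n S) {z : Ref} {q : ℚ}
    (hz : z.arr < 9) (hq : HeightLE S q) : (σ.setNum z q).Ready n S where
  idx_eq_zero := h.idx_eq_zero
  idx_le := h.idx_le
  arr_eq_zero a i j ha := by
    rw [setNum_num, if_neg, h.arr_eq_zero a i j ha]
    rintro ⟨⟩
    omega
  row_eq_zero a i j hi := by
    rw [setNum_num, if_neg, h.row_eq_zero a i j hi]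
    rintro ⟨⟩
    exact absurd (h.idx_le z.row) (by omega)
  col_eq_zero a i j hj := by
    rw [setNum_num, if_neg, h.col_eq_zero a i j hj]
    rintro ⟨⟩
    exact absurd (h.idx_le z.col) (by omega)
  height c := by
    rw [setNum_num]
    split_ifs
    exacts [hq, h.height c]
  dim := h.dim
  one := h.one

theorem Store.Bounded.space_le {n S : ℕ} {σ : Store} (h : σ.Bounded n S) :
    σ.space ≤ 7 * (n + 8) + 9 * (n + 2) ^ 2 * (2 * n + 2 * S + 14) := by
  have hsz (k : ℕ) : k.size ≤ k := Nat.size_le.2 Nat.lt_two_pow_self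
  unfold space
  gcongr
  · have hsub : σ.idx.support ⊆ Finset.range 7 := fun r hr => by
      by_contra hr'
      exact Finsupp.mem_support_iff.1 hr (h.idx_eq_zero r (by simpa using hr'))
    refine (Finset.sum_le_card_nsmul _ _ (n + 8) fun r hr => ?_).trans ?_
    · have h1 := hsz r
      have h2 := hsz (σ.idx r)
      have h3 := h.idx_le r
      have h4 := Finset.mem_range.1 (hsub hr)
      show r.size + (σ.idx r).size ≤ _
      omega
    · exact Nat.mul_le_mul_right _ ((Finset.card_le_card hsub).trans (by simp))
  · have hsub : σ.num.support ⊆ Finset.range 9 ×ˢ Finset.range (n + 2) ×ˢ Finset.range (n + 2) := by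
      rintro ⟨a, i, j⟩ hc
      have hc := Finsupp.mem_support_iff.1 hc
      simp only [Finset.mem_product, Finset.mem_range]
      refine ⟨?_, ?_, ?_⟩ <;> by_contra hlt
      · exact hc (h.arr_eq_zero a i j (by omega))
      · exact hc (h.row_eq_zero a i j (by omega))
      · exact hc (h.col_eq_zero a i j (by omega))
    refine (Finset.sum_le_card_nsmul _ _ (2 * n + 2 * S + 14) ?_).trans ?_
    · rintro ⟨a, i, j⟩ hc
      have hc := hsub hc
      simp only [Finset.mem_product, Finset.mem_range] at hc
      have h0 : a.size ≤ 4 := Nat.size_le.2 (by omega)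
      have h1 := hsz i
      have h2 := hsz j
      have h3 := (h.height (a, i, j)).ratSize_le
      show a.size + i.size + j.size + ratSize (σ.num (a, i, j)) ≤ _
      omega
    · refine Nat.mul_le_mul_right _ ((Finset.card_le_card hsub).trans (le_of_eq ?_))
      simp [sq]

/-! ### Total correctness with a step count and a memory bound -/

/-- The machine goes from `c` to `c'` in `t` steps, and all memories on the way are ready. -/
def Reaches (n S : ℕ) (c c' : Config) (t : ℕ) : Prop :=
  step^[t] c = c' ∧ ∀ k ≤ t, (step^[k] c).store.Ready n S

theorem Reaches.refl {n S : ℕ} {c : Config} (h : c.store.Ready n S) : Reaches n S c c 0 :=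
  ⟨rfl, fun k hk => by obtain rfl : k = 0 := by omega
                       exact h⟩

theorem Reaches.head {n S : ℕ} {c c' : Config} {t : ℕ} (hc : c.store.Ready n S)
    (h : Reaches n S (step c) c' t) : Reaches n S c c' (t + 1) := by
  refine ⟨h.1, fun k hk => ?_⟩
  rcases k with _ | k
  · exact hc
  · exact h.2 k (by omega)

theorem Reaches.trans {n S : ℕ} {c c' c'' : Config} {t u : ℕ} (h : Reaches n S c c' t)
    (h' : Reaches n S c' c'' u) : Reaches n S c c'' (t + u) := by
  refine ⟨by rw [add_comm, Function.iterate_add_apply, h.1, h'.1], fun k hk => ?_⟩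
  rcases le_total k t with hkt | hkt
  · exact h.2 k hkt
  · obtain ⟨l, rfl⟩ := Nat.exists_eq_add_of_le hkt
    rw [add_comm, Function.iterate_add_apply, h.1]
    exact h'.2 l (by omega)

theorem Reaches.ready_left {n S : ℕ} {c c' : Config} {t : ℕ} (h : Reaches n S c c' t) :
    c.store.Ready n S := h.2 0 (Nat.zero_le t)

theorem Reaches.ready_right {n S : ℕ} {c c' : Config} {t : ℕ} (h : Reaches n S c c' t) :
    c'.store.Ready n S := h.1 ▸ h.2 t le_rfl

/-- Started in the memory `σ`, the program `P` comes to its end in at most `P.cost n` steps, in a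
memory that satisfies `Q` and differs from `σ` only where `P` may write, and all memories on the way
are ready. -/
def Prog.Ensures (n S : ℕ) (P : Prog) (σ : Store) (Q : Store → Prop) : Prop :=
  ∀ K, ∃ t ≤ P.cost n, ∃ τ, Reaches n S ⟨P :: K, σ⟩ ⟨K, τ⟩ t ∧ P.Agree σ τ ∧ Q τ

variable {n S : ℕ} {P p q : Prog} {σ : Store} {Q R : Store → Prop}

theorem Prog.Ensures.mono (h : P.Ensures n S σ Q)
    (hQ : ∀ τ, τ.Ready n S → P.Agree σ τ → Q τ → R τ) : P.Ensures n S σ R := fun K => by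
  obtain ⟨t, ht, τ, h1, h2, h3⟩ := h K
  exact ⟨t, ht, τ, h1, h2, hQ τ h1.ready_right h2 h3⟩

theorem Prog.Ensures.of_step {τ : Store} (hP : ∀ K, step ⟨P :: K, σ⟩ = ⟨K, τ⟩)
    (hc : P.cost n = 1) (hσ : σ.Ready n S) (hτ : τ.Ready n S) (hA : P.Agree σ τ) (hQ : Q τ) :
    P.Ensures n S σ Q := fun K =>
  ⟨1, hc.ge, τ, .head hσ ((hP K).symm ▸ .refl hτ), hA, hQ⟩

theorem Prog.Ensures.skip (hσ : σ.Ready n S) (hQ : Q σ) : Prog.skip.Ensures n S σ Q :=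
  .of_step (fun _ => rfl) rfl hσ hσ (.refl _ _) hQ

theorem Prog.Ensures.idxConst {r c : ℕ} (hσ : σ.Ready n S) (hr : 1 < r ∧ r < 7) (hc : c ≤ n + 1)
    (hQ : Q (σ.setIdx r c)) : (Prog.idxConst r c).Ensures n S σ Q :=
  .of_step (fun _ => rfl) rfl hσ (hσ.setIdx hr.2 hr.1 hc)
    ⟨fun s hs => by simp_all [modIdx], fun _ _ _ _ => rfl⟩ hQ

theorem Prog.Ensures.idxAdd {r a b : ℕ} (hσ : σ.Ready n S) (hr : 1 < r ∧ r < 7)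
    (hc : σ.idx a + σ.idx b ≤ n + 1) (hQ : Q (σ.setIdx r (σ.idx a + σ.idx b))) :
    (Prog.idxAdd r a b).Ensures n S σ Q :=
  .of_step (fun _ => rfl) rfl hσ (hσ.setIdx hr.2 hr.1 hc)
    ⟨fun s hs => by simp_all [modIdx], fun _ _ _ _ => rfl⟩ hQ

theorem Store.setNum_num_of_ne {z : Ref} {v : ℚ} {a i j : ℕ} (h : a ≠ z.arr) :
    (σ.setNum z v).num (a, i, j) = σ.num (a, i, j) := by
  rw [setNum_num, if_neg]
  rintro ⟨⟩
  exact h rfl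

theorem Prog.Ensures.numConst {z : Ref} {v : ℚ} (hσ : σ.Ready n S) (hz : z.arr < 9)
    (hv : HeightLE S v) (hQ : Q (σ.setNum z v)) : (Prog.numConst z v).Ensures n S σ Q :=
  .of_step (fun _ => rfl) rfl hσ (hσ.setNum hz hv)
    ⟨fun _ _ => rfl, fun _ ha _ _ => Store.setNum_num_of_ne (by simpa [modArr] using ha)⟩ hQ

theorem Prog.Ensures.arith {o : ArithOp} {z x y : Ref} {v : ℚ} (hσ : σ.Ready n S) (hz : z.arr < 9)
    (ho : o.eval (x.val σ) (y.val σ) = some v) (hv : HeightLE S v) (hQ : Q (σ.setNum z v)) :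
    (Prog.arith o z x y).Ensures n S σ Q :=
  .of_step (fun _ => by simp [step, ho]) rfl hσ (hσ.setNum hz hv)
    ⟨fun _ _ => rfl, fun _ ha _ _ => Store.setNum_num_of_ne (by simpa [modArr] using ha)⟩ hQ

theorem Prog.Ensures.seq (h : p.Ensures n S σ fun τ => q.Ensures n S τ Q) :
    (Prog.seq p q).Ensures n S σ Q := fun K => by
  obtain ⟨t, ht, τ, h1, h2, h3⟩ := h (q :: K)
  obtain ⟨u, hu, ρ, h4, h5, h6⟩ := h3 K
  refine ⟨t + u + 1, by simp only [cost]; omega, ρ, .head h1.ready_left (h1.trans h4), ?_, h6⟩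
  exact (h2.mono (by simp [modIdx]) (by simp [modArr])).trans
    (h5.mono (by simp [modIdx]) (by simp [modArr]))

theorem Prog.Ensures.ite {t : Test} (hσ : σ.Ready n S)
    (hp : t.eval σ = true → p.Ensures n S σ Q) (hq : t.eval σ = false → q.Ensures n S σ Q) :
    (Prog.ite t p q).Ensures n S σ Q := fun K => by
  rcases hb : t.eval σ with _ | _
  · obtain ⟨u, hu, τ, h1, h2, h3⟩ := hq hb K
    refine ⟨u + 1, by simp only [cost]; omega, τ, .head hσ ?_,
      h2.mono (by simp [modIdx]) (by simp [modArr]), h3⟩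
    simpa [step, hb] using h1
  · obtain ⟨u, hu, τ, h1, h2, h3⟩ := hp hb K
    refine ⟨u + 1, by simp only [cost]; omega, τ, .head hσ ?_,
      h2.mono (by simp [modIdx]) (by simp [modArr]), h3⟩
    simpa [step, hb] using h1

/-- The rule for loops: `I k` is an invariant that promises at most `k` further passes, and at most `n`
are promised at the start, as `Prog.cost` presupposes. -/
theorem Prog.Ensures.loop {t : Test} (I : ℕ → Store → Prop) {m : ℕ} (hm : m ≤ n)
    (hσ : σ.Ready n S) (h0 : I m σ)
    (hstep : ∀ k τ, τ.Ready n S → (Prog.loop t p).Agree σ τ → I k τ → t.eval τ = true →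
      ∃ l < k, p.Ensures n S τ (I l))
    (hQ : ∀ k τ, τ.Ready n S → (Prog.loop t p).Agree σ τ → I k τ → t.eval τ = false → Q τ) :
    (Prog.loop t p).Ensures n S σ Q := fun K => by
  suffices h : ∀ k τ, τ.Ready n S → (Prog.loop t p).Agree σ τ → I k τ →
      ∃ u ≤ k * (p.cost n + 1) + 1, ∃ ρ, Reaches n S ⟨.loop t p :: K, τ⟩ ⟨K, ρ⟩ u ∧
        (Prog.loop t p).Agree σ ρ ∧ Q ρ by
    obtain ⟨u, hu, ρ, h1, h2, h3⟩ := h m σ hσ (.refl _ _) h0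
    exact ⟨u, hu.trans (Nat.add_le_add_right (Nat.mul_le_mul_right _ hm) 1), ρ, h1, h2, h3⟩
  intro k
  induction k using Nat.strong_induction_on with
  | _ k ih =>
    intro τ hτ hA hI
    rcases hb : t.eval τ with _ | _
    · refine ⟨1, by omega, τ, .head hτ ?_, hA, hQ k τ hτ hA hI hb⟩
      simpa [step, hb] using Reaches.refl (c := ⟨K, τ⟩) hτ
    · obtain ⟨l, hl, hp⟩ := hstep k τ hτ hA hI hb
      obtain ⟨u, hu, τ', h1, h2, h3⟩ := hp (.loop t p :: K)
      obtain ⟨v, hv, ρ, h4, h5, h6⟩ := ih l hl τ' h1.ready_right (hA.trans (h2.mono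
        (by simp [modIdx]) (by simp [modArr]))) h3
      refine ⟨u + v + 1, ?_, ρ, .head hτ ?_, h5, h6⟩
      · obtain ⟨d, rfl⟩ := Nat.exists_eq_add_of_lt hl
        have : (l + d + 1) * (p.cost n + 1) = l * (p.cost n + 1) + d * (p.cost n + 1)
          + (p.cost n + 1) := by ring
        omega
      · simpa [step, hb] using h1.trans h4

/-- `for r := 0 to n - 1 do p`, where `n` is the dimension. -/
def Prog.forLoop (r : ℕ) (p : Prog) : Prog :=
  .seq (.idxConst r 0) (.loop (.idxLt r 0) (.seq p (.idxAdd r r 1)))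

/-- The rule for counting loops. The invariant must not depend on the counter. -/
theorem Prog.Ensures.forLoop {r : ℕ} (I : ℕ → Store → Prop) (hr : 1 < r ∧ r < 7)
    (hrp : r ∉ p.modIdx) (hI : ∀ i τ v, I i τ → I i (τ.setIdx r v))
    (hσ : σ.Ready n S) (h0 : I 0 σ)
    (hstep : ∀ i < n, ∀ τ, τ.Ready n S → (Prog.forLoop r p).Agree σ τ → τ.idx r = i → I i τ →
      p.Ensures n S τ (I (i + 1)))
    (hQ : ∀ τ, τ.Ready n S → (Prog.forLoop r p).Agree σ τ → I n τ → Q τ) :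
    (Prog.forLoop r p).Ensures n S σ Q := by
  have hA0 : (Prog.forLoop r p).Agree σ (σ.setIdx r 0) :=
    ⟨fun s hs => by simp_all [Prog.forLoop, modIdx], fun _ _ _ _ => rfl⟩
  have hA {τ} (h : (Prog.loop (.idxLt r 0) (.seq p (.idxAdd r r 1))).Agree (σ.setIdx r 0) τ) :
      (Prog.forLoop r p).Agree σ τ :=
    hA0.trans (h.mono (by simp [modIdx, Prog.forLoop]) (by simp [modArr, Prog.forLoop]))
  refine .seq (.idxConst hσ hr (Nat.zero_le _) ?_)
  refine .loop (fun k τ => k + τ.idx r = n ∧ I (τ.idx r) τ) le_rfl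
    (hσ.setIdx hr.2 hr.1 (Nat.zero_le _)) (by simpa using hI _ _ _ h0) ?_ ?_
  · rintro k τ hτ hAg ⟨hk, hIτ⟩ ht
    have ht : τ.idx r < τ.idx 0 := by simpa [Test.eval] using ht
    rw [hτ.dim] at ht
    refine ⟨k - 1, by omega, .seq ((hstep _ ht τ hτ (hA hAg) rfl hIτ).mono
      fun ρ hρ hAρ hIρ => ?_)⟩
    have hρr := hAρ.idx r hrp
    refine .idxAdd hρ hr (by rw [hρ.one]; omega) ?_
    rw [hρ.one, hρr]
    exact ⟨by simp; omega, by simpa using hI _ _ _ hIρ⟩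
  · rintro k τ hτ hAg ⟨hk, hIτ⟩ ht
    have ht : τ.idx 0 ≤ τ.idx r := by simpa [Test.eval] using ht
    rw [hτ.dim] at ht
    obtain rfl : n = τ.idx r := by omega
    exact hQ τ hτ (hA hAg) hIτ

/-- The rule for two nested counting loops, with an invariant that may depend on both counters as
numbers but not on the registers that hold them. -/
theorem Prog.Ensures.forLoop₂ {r s : ℕ} (I : ℕ → ℕ → Store → Prop) (hr : 1 < r ∧ r < 7)
    (hs : 1 < s ∧ s < 7) (hrs : r ≠ s) (hrp : r ∉ p.modIdx) (hsp : s ∉ p.modIdx)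
    (hIr : ∀ i j τ v, I i j τ → I i j (τ.setIdx r v))
    (hIs : ∀ i j τ v, I i j τ → I i j (τ.setIdx s v))
    (hσ : σ.Ready n S) (h0 : I 0 0 σ) (hrow : ∀ i < n, ∀ τ, I i n τ → I (i + 1) 0 τ)
    (hstep : ∀ i < n, ∀ j < n, ∀ τ, τ.Ready n S →
      (Prog.forLoop r (.forLoop s p)).Agree σ τ → τ.idx r = i → τ.idx s = j → I i j τ →
      p.Ensures n S τ (I i (j + 1)))
    (hQ : ∀ τ, τ.Ready n S → (Prog.forLoop r (.forLoop s p)).Agree σ τ → I n 0 τ → Q τ) :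
    (Prog.forLoop r (.forLoop s p)).Ensures n S σ Q := by
  refine .forLoop (fun i => I i 0) hr (by simp [Prog.forLoop, modIdx, hrs, hrp])
    (fun i => hIr i 0) hσ h0 (fun i hi τ hτ hA hi' hIτ => ?_) hQ
  refine .forLoop (I i) hs hsp (hIs i) hτ hIτ (fun j hj ρ hρ hA' hj' hIρ => ?_)
    fun ρ _ _ => hrow i hi ρ
  refine hstep i hi j hj ρ hρ (hA.trans (hA'.mono ?_ ?_)) ?_ hj' hIρ
  · intro x
    simp only [Prog.forLoop, modIdx, List.mem_append, List.mem_cons]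
    tauto
  · simp [Prog.forLoop, modArr]
  · rw [hA'.idx r (by simp [Prog.forLoop, modIdx, hrs, hrp]), hi']

end SymDec

namespace SymDec

open Matrix

set_option linter.unusedSectionVars false

variable {ι : Type*} [Fintype ι] [DecidableEq ι]

/-! ### Sums of squares of matrix entries -/

/-- The square of the Frobenius norm. -/
def sumSq (A : Matrix ι ι ℚ) : ℚ := ∑ i, ∑ j, A i j ^ 2

theorem sumSq_nonneg (A : Matrix ι ι ℚ) : 0 ≤ sumSq A :=
  Finset.sum_nonneg fun _ _ => Finset.sum_nonneg fun _ _ => sq_nonneg _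

theorem sumSq_mul_le (A B : Matrix ι ι ℚ) : sumSq (A * B) ≤ sumSq A * sumSq B := by
  unfold sumSq
  rw [Finset.sum_mul, Finset.sum_comm (f := fun i j => B i j ^ 2)]
  refine Finset.sum_le_sum fun i _ => ?_
  rw [Finset.mul_sum]
  exact Finset.sum_le_sum fun j _ => Finset.sum_mul_sq_le_sq_mul_sq _ _ _

theorem sq_le_sumSq (A : Matrix ι ι ℚ) (i j : ι) : A i j ^ 2 ≤ sumSq A :=
  (Finset.single_le_sum (f := fun j => A i j ^ 2) (fun _ _ => sq_nonneg _)
    (Finset.mem_univ j)).trans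
    (Finset.single_le_sum (f := fun i => ∑ j, A i j ^ 2)
      (fun _ _ => Finset.sum_nonneg fun _ _ => sq_nonneg _) (Finset.mem_univ i))

theorem sumSq_one : sumSq (1 : Matrix ι ι ℚ) = Fintype.card ι := by
  simp [sumSq, Matrix.one_apply]

/-- The matrix of the row operation that adds `α r` times row `i` and `β r` times row `j` to
row `r`, for all `r` at once. -/
def rowOp (i j : ι) (α β : ι → ℚ) : Matrix ι ι ℚ :=
  of fun r => Pi.single r 1 + α r • Pi.single i 1 + β r • Pi.single j 1

theorem rowOp_mul_row (i j : ι) (α β : ι → ℚ) (X : Matrix ι ι ℚ) (r : ι) :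
    (rowOp i j α β * X) r = X r + α r • X i + β r • X j := by
  ext c
  simp [rowOp, Matrix.mul_apply, add_mul, Finset.sum_add_distrib, Pi.single_apply]

theorem sumSq_rowOp_le {i j : ι} (hij : i ≠ j) {α β : ι → ℚ} (hα : ∀ r, |α r| ≤ 1)
    (hβ : ∀ r, |β r| ≤ 1) : sumSq (rowOp i j α β) ≤ 5 * Fintype.card ι := by
  have hrow (r : ι) : ∑ c, rowOp i j α β r c ^ 2 ≤ 5 := by
    have h1 : ∑ c, rowOp i j α β r c ^ 2 = (rowOp i j α β r) ⬝ᵥ (rowOp i j α β r) :=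
      Finset.sum_congr rfl fun _ _ => sq _
    have h2 : rowOp i j α β r =
      (Pi.single r 1 + α r • Pi.single i 1 + β r • Pi.single j 1 : ι → ℚ) := rfl
    rw [h1, h2]
    have ha := abs_le.1 (hα r)
    have hb := abs_le.1 (hβ r)
    have ha2 := (sq_le_one_iff_abs_le_one _).2 (hα r)
    have hb2 := (sq_le_one_iff_abs_le_one _).2 (hβ r)
    simp only [dotProduct_add, add_dotProduct, smul_dotProduct, dotProduct_smul,
      single_dotProduct, Pi.single_apply, one_mul, smul_eq_mul, if_neg hij, if_neg hij.symm]
    rcases eq_or_ne r i with rfl | hi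
    · simp [hij, hij.symm]
      nlinarith
    rcases eq_or_ne r j with rfl | hj
    · simp [hij, hij.symm]
      nlinarith
    · simp [hi, hj, hi.symm, hj.symm]
      nlinarith
  calc sumSq (rowOp i j α β) ≤ ∑ _r : ι, (5 : ℚ) := Finset.sum_le_sum fun r _ => hrow r
    _ = 5 * Fintype.card ι := by simp [mul_comm]

/-! ### One elimination step -/

/-- The elimination step with pivot row `i`, applied to the rows `b` of a matrix: row `j`, multiplied
by `s`, is added to row `i`, and then row `i` is used to make all other rows orthogonal to it with
respect to the bilinear form `β`. -/
def pivotStep (β : LinearMap.BilinForm ℚ (ι → ℚ)) (i j : ι) (s : ℚ) (b : ι → ι → ℚ) :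
    ι → ι → ℚ :=
  fun r => if r = i then b i + s • b j else
    b r - (β (b r) (b i + s • b j) / β (b i + s • b j) (b i + s • b j)) • (b i + s • b j)

/-- The choice of `i`, `j` and `s` in an elimination step, for a matrix with entries
`β (b r) (b c)`: the entry `(i, j)` is largest in absolute value among the off-diagonal ones,
and either the diagonal entry `(i, i)` is at least as large and is the pivot, or row `j` is added to
or subtracted from row `i`, with the sign for which the diagonal entries of the rows `i` and `j` do
not cancel twice the entry `(i, j)`. -/
structure IsPivotChoice (β : LinearMap.BilinForm ℚ (ι → ℚ)) (b : ι → ι → ℚ) (i j : ι) (s : ℚ) :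
    Prop where
  ne : i ≠ j
  entry_ne : β (b i) (b j) ≠ 0
  le : ∀ r c, r ≠ c → |β (b r) (b c)| ≤ |β (b i) (b j)|
  sign : (s = 0 ∧ |β (b i) (b j)| ≤ |β (b i) (b i)|) ∨
    ((s = 1 ∨ s = -1) ∧ |β (b i) (b i)| ≤ |β (b i) (b j)| ∧
      0 ≤ (s * β (b i) (b j)) * (β (b i) (b i) + β (b j) (b j)))

variable {β : LinearMap.BilinForm ℚ (ι → ℚ)} {b : ι → ι → ℚ} {i j : ι} {s : ℚ}

theorem IsPivotChoice.abs_le_one (h : IsPivotChoice β b i j s) : |s| ≤ 1 := by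
  rcases h.sign with ⟨rfl, -⟩ | ⟨rfl | rfl, -⟩ <;> simp

theorem abs_add_two_mul {x y : ℚ} (h : 0 ≤ y * x) : |x + 2 * y| = |x| + 2 * |y| := by
  have : |x + 2 * y| = |x| + |2 * y| := by
    rw [abs_add_eq_add_abs_iff]
    rcases mul_nonneg_iff.1 h with h | h
    · exact .inl ⟨h.2, by linarith⟩
    · exact .inr ⟨h.2, by linarith⟩
  rw [this, abs_mul, abs_two]

/-- After the row addition the pivot dominates its column. -/
theorem IsPivotChoice.dominates (h : IsPivotChoice β b i j s) (hβ : β.IsSymm) :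
    β (b i + s • b j) (b i + s • b j) ≠ 0 ∧
      ∀ r ≠ i, |β (b r) (b i + s • b j)| ≤ |β (b i + s • b j) (b i + s • b j)| := by
  have hpos := abs_pos.2 h.entry_ne
  have hsymm := hβ.eq (b j) (b i)
  rcases h.sign with ⟨rfl, hle⟩ | ⟨hs, hle, hsgn⟩
  · simp only [zero_smul, add_zero]
    exact ⟨abs_pos.1 (hpos.trans_le hle), fun r hr => (h.le r i hr).trans hle⟩
  · have hs2 : s * s = 1 := by rcases hs with rfl | rfl <;> norm_num
    have hsabs : |s| = 1 := by rcases hs with rfl | rfl <;> simp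
    have hpiv : β (b i + s • b j) (b i + s • b j) =
        β (b i) (b i) + β (b j) (b j) + 2 * (s * β (b i) (b j)) := by
      simp only [map_add, map_smul, LinearMap.add_apply, LinearMap.smul_apply, smul_eq_mul, hsymm]
      linear_combination β (b j) (b j) * hs2
    have habs : |β (b i + s • b j) (b i + s • b j)| =
        |β (b i) (b i) + β (b j) (b j)| + 2 * |β (b i) (b j)| := by
      rw [hpiv, abs_add_two_mul hsgn, abs_mul, hsabs, one_mul]
    refine ⟨abs_pos.1 ?_, fun r hr => ?_⟩
    · rw [habs]
      positivity
    · rw [habs, map_add, map_smul, smul_eq_mul]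
      refine (abs_add_le _ _).trans ?_
      rw [abs_mul, hsabs, one_mul]
      rcases eq_or_ne r j with rfl | hrj
      · have h1 := h.le r i hr
        have h2 : |β (b r) (b r)| ≤ |β (b i) (b i) + β (b r) (b r)| + |β (b i) (b i)| := by
          have := abs_add_le (β (b i) (b i) + β (b r) (b r)) (-β (b i) (b i))
          rwa [abs_neg, add_neg_cancel_comm] at this
        linarith
      · have h1 := h.le r i hr
        have h2 := h.le r j hrj
        have h3 := abs_nonneg (β (b i) (b i) + β (b j) (b j))
        linarith

/-- An elimination step is a left multiplication by a matrix that, together with its inverse, has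
rows whose sums of squares are at most `5`. -/
theorem IsPivotChoice.exists_rowOp (h : IsPivotChoice β b i j s) (hβ : β.IsSymm) :
    ∃ G G' : Matrix ι ι ℚ, G * G' = 1 ∧ of (pivotStep β i j s b) = G * of b ∧
      sumSq G ≤ 5 * Fintype.card ι ∧ sumSq G' ≤ 5 * Fintype.card ι := by
  obtain ⟨-, hdom⟩ := h.dominates hβ
  set v := b i + s • b j with hv
  set m : ι → ℚ := fun r => if r = i then 0 else β (b r) v / β v v with hm
  have hmi : m i = 0 := by simp [hm]
  have hm1 (r : ι) : |m r| ≤ 1 := by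
    by_cases hr : r = i
    · simp [hm, hr]
    · simp only [hm, if_neg hr, abs_div]
      exact div_le_one_of_le₀ (hdom r hr) (abs_nonneg _)
  have hs1 := h.abs_le_one
  have hms (r : ι) : |-(m r * s)| ≤ 1 := by
    rw [abs_neg, abs_mul]
    exact mul_le_one₀ (hm1 r) (abs_nonneg _) hs1
  -- the inverse adds the multiples of the pivot row back and then undoes the row addition
  refine ⟨rowOp i j (fun r => -m r) (fun r => if r = i then s else -(m r * s)),
    rowOp i j (fun r => if r = i then -(m j * s) else m r) (fun r => if r = i then -s else 0),
    ?_, ?_, sumSq_rowOp_le h.ne ?_ ?_, sumSq_rowOp_le h.ne ?_ ?_⟩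
  · refine mul_eq_one_comm.1 (funext fun r => ?_)
    rw [rowOp_mul_row]
    have h1 : (1 : Matrix ι ι ℚ) r = Pi.single r 1 := by
      ext c
      simp [Matrix.one_apply, Pi.single_apply, eq_comm]
    rw [h1]
    ext c
    by_cases hr : r = i
    · subst hr
      simp [rowOp, hmi, h.ne.symm]
      ring
    · simp [rowOp, hmi, hr]
      ring
  · refine funext fun r => ?_
    rw [rowOp_mul_row]
    change pivotStep β i j s b r = b r + _ • b i + _ • b j
    by_cases hr : r = i
    · subst hr
      simp [pivotStep, hmi]
    · simp only [pivotStep, if_neg hr, ← hv]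
      have : β (b r) v / β v v = m r := by simp [hm, hr]
      rw [this, hv]
      module
  · exact fun r => by simpa using hm1 r
  · intro r
    split_ifs
    exacts [hs1, hms r]
  · intro r
    split_ifs
    exacts [hms j, hm1 r]
  · intro r
    split_ifs
    · simpa using hs1
    · simp

/-! ### The invariant of the elimination -/

/-- The state of the elimination after the pivots in `J` have been used: `b` are the rows of the
current transformation matrix, and `u` the rows of the matrix that collects only the row additions,
without the eliminations. -/
structure IsPivoted (β : LinearMap.BilinForm ℚ (ι → ℚ)) (J : Finset ι) (b u : ι → ι → ℚ) :
    Prop where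
  orth : ∀ t ∈ J, ∀ r ≠ t, β (b r) (b t) = 0
  pivot_ne : ∀ t ∈ J, β (b t) (b t) ≠ 0
  span_eq : Submodule.span ℚ (b '' J) = Submodule.span ℚ (u '' J)
  sub_mem : ∀ r ∉ J, b r - u r ∈ Submodule.span ℚ (u '' J)

variable {J : Finset ι} {u : ι → ι → ℚ}

/-- Used pivots have no nonzero off-diagonal entry. -/
theorem IsPivoted.notMem_of_ne_zero (h : IsPivoted β J b u) (hβ : β.IsSymm) (hij : i ≠ j)
    (hne : β (b i) (b j) ≠ 0) : i ∉ J ∧ j ∉ J :=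
  ⟨fun hi => hne ((hβ.eq _ _).trans (h.orth i hi j hij.symm)), fun hj => hne (h.orth j hj i hij)⟩

/-- An elimination step does not change the rows of used pivots. -/
theorem IsPivoted.pivotStep_of_mem (h : IsPivoted β J b u) (hi : i ∉ J) (hj : j ∉ J) (hβ : β.IsSymm)
    {t : ι} (ht : t ∈ J) : pivotStep β i j s b t = b t := by
  have hti : t ≠ i := fun h => hi (h ▸ ht)
  have htj : t ≠ j := fun h => hj (h ▸ ht)
  have h1 : β (b t) (b i) = 0 := (hβ.eq _ _).trans (h.orth t ht i hti.symm)
  have h2 : β (b t) (b j) = 0 := (hβ.eq _ _).trans (h.orth t ht j htj.symm)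
  simp [pivotStep, hti, h1, h2]

theorem pivotStep_self : pivotStep β i j s b i = b i + s • b j := by simp [pivotStep]

/-- An elimination step turns row `i` into a used pivot; on the side of `u` only the row addition is
recorded. -/
theorem IsPivoted.step (h : IsPivoted β J b u) (hc : IsPivotChoice β b i j s) (hβ : β.IsSymm) :
    IsPivoted β (insert i J) (pivotStep β i j s b) (Function.update u i (u i + s • u j)) := by
  obtain ⟨hi, hj⟩ := h.notMem_of_ne_zero hβ hc.ne hc.entry_ne
  have hmem {t : ι} (ht : t ∈ J) : pivotStep β i j s b t = b t := h.pivotStep_of_mem hi hj hβ ht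
  have hpiv := (hc.dominates hβ).1
  have himb : pivotStep β i j s b '' ↑(insert i J) = insert (b i + s • b j) (b '' J) := by
    rw [Finset.coe_insert, Set.image_insert_eq, pivotStep_self]
    exact congrArg _ (Set.image_congr fun t ht => hmem ht)
  have himu : Function.update u i (u i + s • u j) '' ↑(insert i J) =
      insert (u i + s • u j) (u '' J) := by
    rw [Finset.coe_insert, Set.image_insert_eq, Function.update_self]
    refine congrArg _ (Set.image_congr fun t ht => Function.update_of_ne ?_ _ _)
    rintro rfl
    exact hi ht
  have hdiff : (b i + s • b j) - (u i + s • u j) ∈ Submodule.span ℚ (u '' J) := by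
    have := add_mem (h.sub_mem i hi) (Submodule.smul_mem _ s (h.sub_mem j hj))
    convert this using 1
    module
  have hspan : Submodule.span ℚ (insert (b i + s • b j) (b '' J)) =
      Submodule.span ℚ (insert (u i + s • u j) (u '' J)) := by
    rw [Submodule.span_insert, Submodule.span_insert, h.span_eq]
    apply le_antisymm <;> refine sup_le ((Submodule.span_singleton_le_iff_mem _ _).2 ?_) le_sup_right
    · rw [← add_sub_cancel (u i + s • u j) (b i + s • b j)]
      exact add_mem (Submodule.mem_sup_left (Submodule.mem_span_singleton_self _))
        (Submodule.mem_sup_right hdiff)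
    · rw [← sub_sub_cancel (b i + s • b j) (u i + s • u j)]
      exact _root_.sub_mem (Submodule.mem_sup_left (Submodule.mem_span_singleton_self _))
        (Submodule.mem_sup_right hdiff)
  refine ⟨fun t ht r hr => ?_, fun t ht => ?_, by rw [himb, himu, hspan], fun r hr => ?_⟩
  · rcases Finset.mem_insert.1 ht with rfl | htJ
    · rw [pivotStep_self, pivotStep, if_neg hr, map_sub, map_smul, LinearMap.sub_apply,
        LinearMap.smul_apply, smul_eq_mul, div_mul_cancel₀ _ hpiv, sub_self]
    · have hv : β (b i + s • b j) (b t) = 0 := by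
        rw [map_add, map_smul, LinearMap.add_apply, LinearMap.smul_apply,
          h.orth t htJ i (fun h => hi (h ▸ htJ)), h.orth t htJ j (fun h => hj (h ▸ htJ)),
          smul_zero, add_zero]
      rw [hmem htJ, pivotStep]
      split_ifs with hri
      · exact hv
      · rw [map_sub, map_smul, LinearMap.sub_apply, LinearMap.smul_apply, hv, h.orth t htJ r hr,
          smul_zero, sub_zero]
  · rcases Finset.mem_insert.1 ht with rfl | htJ
    · rwa [pivotStep_self]
    · rw [hmem htJ]
      exact h.pivot_ne t htJ
  · rw [Finset.mem_insert, not_or] at hr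
    rw [himu, ← hspan, Function.update_of_ne hr.1, pivotStep, if_neg hr.1, sub_right_comm]
    refine _root_.sub_mem (Submodule.span_mono (Set.subset_insert _ _) (h.span_eq ▸ h.sub_mem r hr.2))
      (Submodule.smul_mem _ _ (Submodule.subset_span (Set.mem_insert _ _)))

/-! ### Denominators -/

theorem exists_sum_eq_of_mem_span_image {x : ι → ℚ} (hx : x ∈ Submodule.span ℚ (u '' J)) :
    ∃ c : ι → ℚ, (∀ t ∉ J, c t = 0) ∧ ∑ t, c t • u t = x := by
  obtain ⟨c, rfl⟩ := (Submodule.mem_span_image_finset_iff_exists_fun ℚ).1 hx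
  refine ⟨fun t => if h : t ∈ J then c ⟨t, h⟩ else 0, fun t ht => dif_neg ht, ?_⟩
  rw [← Finset.sum_subset (Finset.subset_univ J) fun t _ ht => by simp [ht], ← Finset.sum_coe_sort J]
  exact Finset.sum_congr rfl fun t _ => by simp

/-- The matrix whose column `t` is that of `g` for `t` in `J`, and the unit vector at `t` otherwise.
Here `g` stands for an integer multiple of the Gram matrix of the rows `u`. -/
def gramOn (J : Finset ι) (g : Matrix ι ι ℤ) : Matrix ι ι ℤ :=
  of fun r t => if t ∈ J then g r t else (1 : Matrix ι ι ℤ) r t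

theorem vecMul_gramOn {g : Matrix ι ι ℤ} {Δ : ℤ} (hg : ∀ r t, (g r t : ℚ) = Δ * β (u r) (u t))
    (l : ι → ℚ) (t : ι) : (l ᵥ* (gramOn J g).map (Int.cast : ℤ → ℚ)) t =
      if t ∈ J then Δ * β (∑ r, l r • u r) (u t) else l t := by
  rw [Matrix.vecMul_eq_sum, Finset.sum_apply]
  split_ifs with ht
  · rw [map_sum, LinearMap.sum_apply, Finset.mul_sum]
    refine Finset.sum_congr rfl fun r _ => ?_
    simp only [Pi.smul_apply, smul_eq_mul, Matrix.map_apply, gramOn, of_apply, if_pos ht, hg,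
      map_smul, LinearMap.smul_apply]
    ring
  · simp [gramOn, ht, Matrix.one_apply]

theorem apply_eq_zero_of_mem_span_image {x y : ι → ℚ} (hx : ∀ t ∈ J, β x (u t) = 0)
    (hy : y ∈ Submodule.span ℚ (u '' J)) : β x y = 0 := by
  induction hy using Submodule.span_induction with
  | mem y hy =>
    obtain ⟨t, ht, rfl⟩ := hy
    exact hx t ht
  | zero => simp
  | add y z _ _ hy hz => rw [map_add, hy, hz, add_zero]
  | smul a y _ hy => rw [map_smul, hy, smul_zero]

/-- The form is nondegenerate on the span of the rows that have served as pivots. -/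
theorem IsPivoted.eq_zero_of_orth (h : IsPivoted β J b u) {y : ι → ℚ}
    (hy : y ∈ Submodule.span ℚ (u '' J)) (horth : ∀ t ∈ J, β y (u t) = 0) : y = 0 := by
  obtain ⟨c, hc, rfl⟩ := exists_sum_eq_of_mem_span_image (h.span_eq ▸ hy)
  refine Finset.sum_eq_zero fun t _ => ?_
  by_cases ht : t ∈ J
  · have hbt : b t ∈ Submodule.span ℚ (u '' J) := h.span_eq ▸ Submodule.subset_span ⟨t, ht, rfl⟩
    have h0 := apply_eq_zero_of_mem_span_image horth hbt
    rw [map_sum, LinearMap.sum_apply, Finset.sum_eq_single t] at h0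
    · rw [map_smul, LinearMap.smul_apply, smul_eq_mul, mul_eq_zero] at h0
      rw [h0.resolve_right (h.pivot_ne t ht), zero_smul]
    · intro r _ hr
      rw [map_smul, LinearMap.smul_apply, h.orth t ht r hr, smul_zero]
    · simp
  · rw [hc t ht, zero_smul]

/-- By Cramer's rule, a determinant of bounded integers is a common denominator of all rows that
have not yet served as a pivot. -/
theorem IsPivoted.exists_denominator {U : Matrix ι ι ℤ}
    (h : IsPivoted β J b fun r t => (U r t : ℚ)) (hU : U.det ≠ 0) {g : Matrix ι ι ℤ} {Δ : ℤ}
    (hΔ : Δ ≠ 0) (hg : ∀ r t, (g r t : ℚ) = Δ * β (fun c => (U r c : ℚ)) (fun c => (U t c : ℚ)))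
    {M : ℕ} (hM : 1 ≤ M) (hgM : ∀ r t, (g r t).natAbs ≤ M) :
    ∃ d : ℤ, d ≠ 0 ∧ d.natAbs ≤ (Fintype.card ι).factorial * M ^ Fintype.card ι ∧
      ∀ r ∉ J, ∀ t, ∃ a : ℤ, d * b r t = a := by
  set u : ι → ι → ℚ := fun r t => (U r t : ℚ) with hu
  set N := gramOn J g with hN
  have hcast : ((N.det : ℤ) : ℚ) = (N.map (Int.cast : ℤ → ℚ)).det := by
    simpa using RingHom.map_det (Int.castRingHom ℚ) N
  have hΔ' : (Δ : ℚ) ≠ 0 := by exact_mod_cast hΔ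
  have hUq : ((U.map (Int.cast : ℤ → ℚ)).det) ≠ 0 := by
    have : ((U.det : ℤ) : ℚ) = (U.map (Int.cast : ℤ → ℚ)).det := by
      simpa using RingHom.map_det (Int.castRingHom ℚ) U
    rw [← this]
    exact_mod_cast hU
  -- a left kernel vector is supported on `J` and gives an element of the radical on the span of `u '' J`
  have hdet : N.det ≠ 0 := by
    intro h0
    rw [h0, Int.cast_zero, eq_comm, ← Matrix.exists_vecMul_eq_zero_iff] at hcast
    obtain ⟨v, hv0, hv⟩ := hcast
    have hvt (t : ι) := (vecMul_gramOn (J := J) hg v t).symm.trans (congrFun hv t)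
    have hsum : ∑ t, v t • u t = 0 := by
      refine h.eq_zero_of_orth (Submodule.sum_mem _ fun t _ => ?_) fun t ht => ?_
      · by_cases ht : t ∈ J
        · exact Submodule.smul_mem _ _ (Submodule.subset_span ⟨t, ht, rfl⟩)
        · have := hvt t
          rw [if_neg ht, Pi.zero_apply] at this
          rw [this, zero_smul]
          exact zero_mem _
      · have := hvt t
        rw [if_pos ht, Pi.zero_apply, mul_eq_zero] at this
        exact this.resolve_left hΔ'
    refine hv0 (Matrix.eq_zero_of_vecMul_eq_zero hUq ?_)
    rw [Matrix.vecMul_eq_sum]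
    exact hsum
  refine ⟨N.det, hdet, ?_, fun r hr => ?_⟩
  · have hle (i j : ι) : AbsoluteValue.abs (N i j) ≤ (M : ℤ) := by
      change |N i j| ≤ _
      rw [Int.abs_eq_natAbs, Nat.cast_le]
      simp only [hN, gramOn, of_apply]
      split_ifs
      · exact hgM i j
      · rw [Matrix.one_apply]
        split_ifs <;> simp [hM]
    have := Matrix.det_le hle
    change |N.det| ≤ _ at this
    rw [Int.abs_eq_natAbs, nsmul_eq_mul] at this
    exact_mod_cast this
  · obtain ⟨c, hc, hcsum⟩ := exists_sum_eq_of_mem_span_image (h.sub_mem r hr)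
    have hbr : ∑ t, (c + Pi.single r 1 : ι → ℚ) t • u t = b r := by
      simp only [Pi.add_apply, add_smul, Finset.sum_add_distrib, hcsum, Pi.single_apply, ite_smul,
        one_smul, zero_smul, Finset.sum_ite_eq', Finset.mem_univ, if_true, sub_add_cancel]
    -- the coefficients of `b r` solve a linear system with matrix `N`, so Cramer's rule applies
    have hsol : (c + Pi.single r 1) ᵥ* N.map (Int.cast : ℤ → ℚ) = Pi.single r 1 := by
      ext t
      rw [vecMul_gramOn hg]
      split_ifs with ht
      · rw [hbr, apply_eq_zero_of_mem_span_image (fun t ht => h.orth t ht r fun h => hr (h ▸ ht))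
          (h.span_eq ▸ Submodule.subset_span ⟨t, ht, rfl⟩), mul_zero, Pi.single_eq_of_ne]
        rintro rfl
        exact hr ht
      · simp [hc t ht]
    have hcramer (t : ι) : (N.det : ℚ) * (c + Pi.single r 1 : ι → ℚ) t = (N.adjugate r t : ℤ) := by
      have h1 := congrArg (· ᵥ* (N.map (Int.cast : ℤ → ℚ)).adjugate) hsol
      simp only [Matrix.vecMul_vecMul, Matrix.mul_adjugate, Matrix.vecMul_smul, Matrix.vecMul_one,
        ← hcast, Matrix.single_one_vecMul] at h1
      have h2 : (N.map (Int.cast : ℤ → ℚ)).adjugate = N.adjugate.map Int.cast := by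
        simpa using (RingHom.map_adjugate (Int.castRingHom ℚ) N).symm
      rw [h2] at h1
      simpa using congrFun h1 t
    refine fun t => ⟨∑ k, N.adjugate r k * U k t, ?_⟩
    rw [← hbr, Finset.sum_apply, Finset.mul_sum]
    rw [Int.cast_sum]
    refine Finset.sum_congr rfl fun k _ => ?_
    rw [Int.cast_mul, ← hcramer k, Pi.smul_apply, smul_eq_mul, mul_assoc]

end SymDec

namespace SymDec

open Matrix

variable {n : ℕ} {H B : Matrix (Fin n) (Fin n) ℚ} {J : Finset (Fin n)} {i j : Fin n} {s : ℚ}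

/-! ### Growth of the transformation matrix and of its entries -/

theorem sq_le_matSize (H : Matrix (Fin n) (Fin n) ℚ) : n ^ 2 ≤ matSize H := by
  have h : ∑ _i : Fin n, ∑ _j : Fin n, 1 ≤ matSize H :=
    Finset.sum_le_sum fun i _ => Finset.sum_le_sum fun j _ => by
      unfold ratSize
      omega
  simpa [sq] using h

theorem le_matSize (H : Matrix (Fin n) (Fin n) ℚ) : n ≤ matSize H :=
  (Nat.le_self_pow two_ne_zero n).trans (sq_le_matSize H)

theorem ratSize_le_matSize (H : Matrix (Fin n) (Fin n) ℚ) (i j : Fin n) :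
    ratSize (H i j) ≤ matSize H :=
  (Finset.single_le_sum (f := fun j => ratSize (H i j)) (fun _ _ => Nat.zero_le _)
    (Finset.mem_univ j)).trans
    (Finset.single_le_sum (f := fun i => ∑ j, ratSize (H i j))
      (fun _ _ => Nat.zero_le _) (Finset.mem_univ i))

theorem exists_integer_multiple (H : Matrix (Fin n) (Fin n) ℚ) :
    ∃ Δ : ℤ, ∃ W : Matrix (Fin n) (Fin n) ℤ, Δ ≠ 0 ∧ (∀ i j, (W i j : ℚ) = Δ * H i j) ∧
      ∀ i j, (W i j).natAbs ≤ 2 ^ (2 * matSize H) := by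
  set Δ : ℕ := ∏ i, ∏ j, (H i j).den with hΔ
  have hdvd (i j : Fin n) : (H i j).den ∣ Δ :=
    (Finset.dvd_prod_of_mem (fun j => (H i j).den) (Finset.mem_univ j)).trans
      (Finset.dvd_prod_of_mem (fun i => ∏ j, (H i j).den) (Finset.mem_univ i))
  have hΔ0 : Δ ≠ 0 := by
    simp [hΔ, Finset.prod_eq_zero_iff]
  have hΔle : Δ ≤ 2 ^ matSize H := by
    rw [hΔ, matSize, ← Finset.prod_pow_eq_pow_sum]
    refine Finset.prod_le_prod' fun i _ => ?_
    rw [← Finset.prod_pow_eq_pow_sum]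
    exact Finset.prod_le_prod' fun j _ => (HeightLE.of_ratSize_le le_rfl).2
  refine ⟨Δ, of fun i j => (H i j).num * ((Δ / (H i j).den : ℕ) : ℤ), by exact_mod_cast hΔ0,
    fun i j => ?_, fun i j => ?_⟩
  · rw [of_apply, Int.cast_mul, Int.cast_natCast, Int.cast_natCast,
      Nat.cast_div (hdvd i j) (by simp)]
    conv_rhs => rw [← Rat.num_div_den (H i j)]
    ring
  · rw [of_apply, Int.natAbs_mul, Int.natAbs_natCast, two_mul, pow_add]
    exact Nat.mul_le_mul (HeightLE.of_ratSize_le (ratSize_le_matSize H i j)).1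
      ((Nat.div_le_self _ _).trans hΔle)

theorem natAbs_mul_apply_le {A A' : Matrix (Fin n) (Fin n) ℤ} {a b : ℕ}
    (hA : ∀ i j, (A i j).natAbs ≤ a) (hA' : ∀ i j, (A' i j).natAbs ≤ b) (i j : Fin n) :
    ((A * A') i j).natAbs ≤ n * (a * b) := by
  rw [Matrix.mul_apply]
  refine (Int.natAbs_sum_le _ _).trans ?_
  refine (Finset.sum_le_card_nsmul _ _ (a * b) fun k _ => ?_).trans (by simp)
  rw [Int.natAbs_mul]
  exact Nat.mul_le_mul (hA i k) (hA' k j)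

theorem mul_mul_transpose_apply (B H : Matrix (Fin n) (Fin n) ℚ) (i j : Fin n) :
    (B * H * Bᵀ) i j = Matrix.toBilin' H (B i) (B j) := by
  rw [Matrix.toBilin'_apply', Matrix.dotProduct_mulVec]
  rfl

/-- The vector `v` has a common denominator of absolute value at most `X`. -/
def HasDenominatorLE (X : ℕ) (v : Fin n → ℚ) : Prop :=
  ∃ d : ℤ, d ≠ 0 ∧ d.natAbs ≤ X ∧ ∀ t, ∃ a : ℤ, d * v t = a

/-- The invariant of the algorithm after the pivots in `J`: the elimination is in the state
`IsPivoted` relative to a unimodular integer matrix `U` with small entries, `B` and its inverse have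
grown, in squared norm, by at most a factor `5 * n` per pivot, and the rows that have served as pivots
have denominators of polynomial length. The last field saves one factor `5 * n`, which pays for the
norm of the identity; the alternative `J.card = 0` is needed only if `n = 0`. -/
structure Progress (H : Matrix (Fin n) (Fin n) ℚ) (J : Finset (Fin n))
    (B : Matrix (Fin n) (Fin n) ℚ) : Prop where
  exists_rowAdditions : ∃ U : Matrix (Fin n) (Fin n) ℤ, U.det = 1 ∧
    (∀ i j, (U i j).natAbs ≤ 2 ^ J.card) ∧
    IsPivoted (Matrix.toBilin' H) J B fun r t => (U r t : ℚ)
  exists_inverse : ∃ C, B * C = 1 ∧ sumSq C ≤ n * (5 * n) ^ J.card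
  sumSq_le : sumSq B ≤ n * (5 * n) ^ J.card
  denominator : ∀ t ∈ J, HasDenominatorLE (2 ^ (6 * matSize H ^ 2 + matSize H)) (B t)
  card_lt : J.card = 0 ∨ J.card < n

theorem Progress.init (H : Matrix (Fin n) (Fin n) ℚ) : Progress H ∅ 1 where
  exists_rowAdditions := by
    refine ⟨1, by simp, fun i j => ?_, by simp, by simp,
      by rw [Finset.coe_empty, Set.image_empty]; exact congrArg _ (Set.image_empty _), fun r _ => ?_⟩
    · rw [Matrix.one_apply]
      split_ifs <;> simp
    · have : (1 : Matrix (Fin n) (Fin n) ℚ) r -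
          (fun t => ((1 : Matrix (Fin n) (Fin n) ℤ) r t : ℚ)) = 0 := by
        ext c
        simp [Matrix.one_apply]
      rw [this]
      exact zero_mem _
  exists_inverse := ⟨1, by simp, by simp [sumSq_one]⟩
  sumSq_le := by simp [sumSq_one]
  denominator := by simp
  card_lt := by simp

theorem Progress.card_le (h : Progress H J B) : J.card ≤ n := by
  have := h.card_lt
  omega

theorem Progress.exists_denominator (h : Progress H J B) :
    ∃ d : ℤ, d ≠ 0 ∧ d.natAbs ≤ 2 ^ (6 * matSize H ^ 2 + matSize H) ∧
      ∀ r ∉ J, ∀ t, ∃ a : ℤ, d * B r t = a := by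
  obtain ⟨U, hU, hUle, hP⟩ := h.exists_rowAdditions
  obtain ⟨Δ, W, hΔ, hW, hWle⟩ := exists_integer_multiple H
  have hn := le_matSize H
  have hn2 := sq_le_matSize H
  have hUle' (i j : Fin n) : (U i j).natAbs ≤ 2 ^ n :=
    (hUle i j).trans (Nat.pow_le_pow_right two_pos h.card_le)
  have hg (r t : Fin n) : ((U * W * Uᵀ) r t : ℚ) = Δ * Matrix.toBilin' H
      (fun c => (U r c : ℚ)) (fun c => (U t c : ℚ)) := by
    rw [Matrix.toBilin'_apply', Matrix.dotProduct_mulVec]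
    simp only [dotProduct, vecMul, Matrix.mul_apply, transpose_apply, Int.cast_sum, Int.cast_mul, hW,
      Finset.mul_sum, Finset.sum_mul]
    refine Finset.sum_congr rfl fun c _ => Finset.sum_congr rfl fun k _ => ?_
    ring
  have hgle (r t : Fin n) : ((U * W * Uᵀ) r t).natAbs ≤ 2 ^ (6 * matSize H) := by
    refine (natAbs_mul_apply_le (natAbs_mul_apply_le hUle' hWle) (fun i j => hUle' j i) r t).trans ?_
    have h2 : n ≤ 2 ^ n := Nat.lt_two_pow_self.le
    calc n * (n * (2 ^ n * 2 ^ (2 * matSize H)) * 2 ^ n)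
        ≤ 2 ^ n * (2 ^ n * (2 ^ n * 2 ^ (2 * matSize H)) * 2 ^ n) := by gcongr
      _ = 2 ^ (4 * n + 2 * matSize H) := by ring
      _ ≤ 2 ^ (6 * matSize H) := Nat.pow_le_pow_right two_pos (by omega)
  obtain ⟨d, hd0, hd, hda⟩ := hP.exists_denominator (by rw [hU]; exact one_ne_zero) hΔ hg
    Nat.one_le_two_pow hgle
  refine ⟨d, hd0, hd.trans ?_, hda⟩
  rw [Fintype.card_fin]
  calc n.factorial * (2 ^ (6 * matSize H)) ^ n
      ≤ (2 ^ n) ^ n * (2 ^ (6 * matSize H)) ^ n := by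
        gcongr
        exact (Nat.factorial_le_pow n).trans (Nat.pow_le_pow_left Nat.lt_two_pow_self.le n)
    _ = 2 ^ (6 * (matSize H * n) + n ^ 2) := by ring
    _ ≤ 2 ^ (6 * matSize H ^ 2 + matSize H) := by
        refine Nat.pow_le_pow_right two_pos ?_
        have := Nat.mul_le_mul_left (matSize H) hn
        rw [sq (matSize H)]
        omega

/-- At most `n - 1` steps leave room for the squared norm `n` of the identity. -/
theorem mul_pow_le_of_lt {k : ℕ} (h : k = 0 ∨ k < n) :
    (n : ℚ) * (5 * n) ^ k ≤ (5 * n) ^ n := by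
  rcases Nat.eq_zero_or_pos n with rfl | hn
  · simp
  have hn1 : (1 : ℚ) ≤ n := by exact_mod_cast hn
  calc (n : ℚ) * (5 * n) ^ k ≤ (5 * n) * (5 * n) ^ k := by gcongr; linarith
    _ = (5 * n) ^ (k + 1) := by ring
    _ ≤ (5 * n) ^ n := pow_le_pow_right₀ (by linarith) (by omega)

/-- A bound for the heights of the entries of the transformation matrix: the length of a common
denominator plus `4 * matSize H`, a bound for the logarithm of `(5 * n) ^ n`. -/
def entryHeight (H : Matrix (Fin n) (Fin n) ℚ) : ℕ := 6 * matSize H ^ 2 + 5 * matSize H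

theorem Progress.heightLE (h : Progress H J B) (i j : Fin n) :
    HeightLE (entryHeight H) (B i j) := by
  obtain ⟨d, hd0, hd, hda⟩ : HasDenominatorLE (2 ^ (6 * matSize H ^ 2 + matSize H)) (B i) := by
    by_cases hi : i ∈ J
    · exact h.denominator i hi
    · obtain ⟨d, hd0, hd, hda⟩ := h.exists_denominator
      exact ⟨d, hd0, hd, hda i hi⟩
  obtain ⟨a, ha⟩ := hda j
  have hd0' : (d : ℚ) ≠ 0 := by exact_mod_cast hd0
  have hn : 1 ≤ n := i.pos
  have hY : (5 * n) ^ n ≤ 2 ^ (4 * matSize H) := by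
    calc (5 * n) ^ n ≤ (2 ^ 3 * 2 ^ n) ^ n := by
          gcongr
          · norm_num
          · exact Nat.lt_two_pow_self.le
      _ = 2 ^ (3 * n + n ^ 2) := by rw [← pow_add, ← pow_mul]; ring_nf
      _ ≤ 2 ^ (4 * matSize H) := by
          refine Nat.pow_le_pow_right two_pos ?_
          have := sq_le_matSize H
          have := le_matSize H
          omega
  have hB : |B i j| ≤ 2 ^ (4 * matSize H) := by
    refine abs_le_of_sq_le_sq ?_ (by positivity)
    have h1 : (1 : ℚ) ≤ 2 ^ (4 * matSize H) := one_le_pow₀ (by norm_num)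
    have h2 := (sq_le_sumSq B i j).trans (h.sumSq_le.trans (mul_pow_le_of_lt h.card_lt))
    have h3 : ((5 * n) ^ n : ℚ) ≤ 2 ^ (4 * matSize H) := by exact_mod_cast hY
    nlinarith
  refine .of_eq_div hd0 (by rw [← ha]; field_simp) ?_ (hd.trans ?_)
  · have h1 : (a.natAbs : ℚ) = d.natAbs * |B i j| := by
      rw [Nat.cast_natAbs, Nat.cast_natAbs, Int.cast_abs, Int.cast_abs, ← abs_mul, ha]
    have h2 : (a.natAbs : ℚ) ≤ (2 ^ (6 * matSize H ^ 2 + matSize H) : ℕ) * 2 ^ (4 * matSize H) := by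
      rw [h1]
      gcongr
    have h3 : a.natAbs ≤ 2 ^ (6 * matSize H ^ 2 + matSize H) * 2 ^ (4 * matSize H) := by
      exact_mod_cast h2
    refine h3.trans (le_of_eq ?_)
    rw [← pow_add, entryHeight]
    congr 1
    ring
  · exact Nat.pow_le_pow_right two_pos (by unfold entryHeight; omega)

theorem toBilin'_isSymm (hH : H.IsSymm) : (Matrix.toBilin' H).IsSymm := ⟨fun x y => by
  rw [Matrix.toBilin'_apply', Matrix.toBilin'_apply', Matrix.dotProduct_mulVec,
    ← Matrix.mulVec_transpose, hH.eq, dotProduct_comm]⟩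

theorem Progress.step (h : Progress H J B) (hH : H.IsSymm)
    (hc : IsPivotChoice (Matrix.toBilin' H) B i j s) :
    ∃ J' : Finset (Fin n), J'.card = J.card + 1 ∧
      Progress H J' (of (pivotStep (Matrix.toBilin' H) i j s B)) := by
  have hβ := toBilin'_isSymm hH
  obtain ⟨U, hU, hUle, hP⟩ := h.exists_rowAdditions
  obtain ⟨hi, hj⟩ := hP.notMem_of_ne_zero hβ hc.ne hc.entry_ne
  have hcard : (insert i J).card = J.card + 1 := Finset.card_insert_of_notMem hi
  obtain ⟨G, G', hGG, hG, hGle, hGle'⟩ := hc.exists_rowOp hβ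
  rw [Fintype.card_fin] at hGle hGle'
  obtain ⟨z, hz, hz1⟩ : ∃ z : ℤ, s = z ∧ z.natAbs ≤ 1 := by
    rcases hc.sign with ⟨h, -⟩ | ⟨h | h, -⟩
    exacts [⟨0, by simp [h]⟩, ⟨1, by simp [h]⟩, ⟨-1, by simp [h]⟩]
  refine ⟨insert i J, hcard, ?_, ?_, ?_, ?_, .inr ?_⟩
  · refine ⟨U.updateRow i (U i + z • U j), ?_, fun r t => ?_, ?_⟩
    · rw [Matrix.det_updateRow_add_smul_self _ hc.ne, hU]
    · rw [hcard, pow_succ, Matrix.updateRow_apply]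
      have h1 := hUle i t
      have h2 := hUle j t
      have h3 := hUle r t
      have h4 := Nat.mul_le_mul hz1 h2
      have h5 := Int.natAbs_add_le (U i t) (z * U j t)
      rw [Int.natAbs_mul] at h5
      split_ifs
      · simp only [Pi.add_apply, Pi.smul_apply, smul_eq_mul]
        omega
      · omega
    · have hrows : (fun r t => ((U.updateRow i (U i + z • U j) r t : ℤ) : ℚ)) =
          Function.update (fun r t => (U r t : ℚ)) i
            ((fun t => (U i t : ℚ)) + s • fun t => (U j t : ℚ)) := by
        ext r t
        by_cases hr : r = i
        · subst hr
          simp [hz]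
        · simp [hr]
      rw [hrows]
      exact hP.step hc hβ
  · obtain ⟨C, hC, hCle⟩ := h.exists_inverse
    refine ⟨C * G', ?_, ?_⟩
    · rw [hG, show of (B : Fin n → Fin n → ℚ) = B from rfl, ← Matrix.mul_assoc, Matrix.mul_assoc G,
        hC, Matrix.mul_one, hGG]
    · refine (sumSq_mul_le _ _).trans ((mul_le_mul hCle hGle' (sumSq_nonneg _)
        (by positivity)).trans (le_of_eq ?_))
      rw [hcard]
      ring
  · rw [hG]
    refine (sumSq_mul_le _ _).trans ((mul_le_mul hGle h.sumSq_le (sumSq_nonneg _)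
      (by positivity)).trans (le_of_eq ?_))
    rw [hcard]
    ring
  · intro t ht
    rcases Finset.mem_insert.1 ht with rfl | htJ
    · -- the rows `t` and `j` have the same denominator `d`, which also works for their combination
      obtain ⟨d, hd0, hd, hda⟩ := h.exists_denominator
      refine ⟨d, hd0, hd, fun c => ?_⟩
      obtain ⟨a, ha⟩ := hda t hi c
      obtain ⟨a', ha'⟩ := hda j hj c
      refine ⟨a + z * a', ?_⟩
      have hrow : of (pivotStep (Matrix.toBilin' H) t j s B) t = B t + s • B j := pivotStep_self
      rw [hrow, Pi.add_apply, Pi.smul_apply, smul_eq_mul, hz]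
      push_cast
      rw [← ha, ← ha']
      ring
    · have : of (pivotStep (Matrix.toBilin' H) i j s B) t = B t :=
        hP.pivotStep_of_mem hi hj hβ htJ
      rw [this]
      exact h.denominator t htJ
  · -- `j` is still unused, so `insert i J` is not everything
    rw [hcard, ← Finset.card_insert_of_notMem hi]
    refine (Finset.card_lt_univ_of_notMem (x := j) ?_).trans_eq (Fintype.card_fin n)
    simp [hj, hc.ne.symm]

theorem frobeniusNorm_le {A : Matrix (Fin n) (Fin n) ℚ} (h : sumSq A ≤ (5 * n) ^ n) :
    frobeniusNorm A ≤ (5 * (n : ℝ)) ^ ((n : ℝ) / 2) := by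
  have h1 : ∑ i, ∑ j, (A i j : ℝ) ^ 2 = (sumSq A : ℚ) := by simp [sumSq]
  have h2 : ((sumSq A : ℚ) : ℝ) ≤ (5 * n) ^ n := by exact_mod_cast h
  rw [frobeniusNorm, h1]
  refine (Real.sqrt_le_sqrt h2).trans (le_of_eq ?_)
  rw [Real.sqrt_eq_rpow, ← Real.rpow_natCast, ← Real.rpow_mul (by positivity)]
  ring_nf

theorem Progress.frobeniusNorm_le (h : Progress H J B) :
    frobeniusNorm B ≤ (5 * (n : ℝ)) ^ ((n : ℝ) / 2) ∧
      frobeniusNorm B⁻¹ ≤ (5 * (n : ℝ)) ^ ((n : ℝ) / 2) := by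
  obtain ⟨C, hC, hCle⟩ := h.exists_inverse
  rw [Matrix.inv_eq_right_inv hC]
  exact ⟨SymDec.frobeniusNorm_le (h.sumSq_le.trans (mul_pow_le_of_lt h.card_lt)),
    SymDec.frobeniusNorm_le (hCle.trans (mul_pow_le_of_lt h.card_lt))⟩

theorem Progress.isUnit_det (h : Progress H J B) : IsUnit B.det := by
  obtain ⟨C, hC, -⟩ := h.exists_inverse
  exact Matrix.isUnit_det_of_right_inverse hC

end SymDec

namespace SymDec

open Prog

/-! ### Matrix products -/

/-- The data register of array `a` that index register `7`, which is always `0`, addresses. -/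
abbrev scalar (a : ℕ) : Ref := ⟨a, 7, 7⟩

/-- Entry `(i, j)` of array `a` becomes the sum over `k` of `x * y`, for all `i` and `j`, where `i`,
`j`, `k` are the contents of the index registers `2`, `3`, `4` and `x` and `y` may refer to them. -/
def matMul (a : ℕ) (x y : Ref) : Prog :=
  forLoop 2 <| forLoop 3 <| seq (numConst ⟨a, 2, 3⟩ 0) <| forLoop 4 <|
    seq (arith .mul (scalar 4) x y) (arith .add ⟨a, 2, 3⟩ ⟨a, 2, 3⟩ (scalar 4))

variable {n S : ℕ} {σ : Store}

theorem Store.Ready.scalar_val (hσ : σ.Ready n S) (a : ℕ) : (scalar a).val σ = σ.num (a, 0, 0) := by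
  simp [Ref.val, Ref.addr, hσ.idx_eq_zero 7 le_rfl]

theorem Store.Ready.scalar_addr (hσ : σ.Ready n S) (a : ℕ) : (scalar a).addr σ = (a, 0, 0) := by
  simp [Ref.addr, hσ.idx_eq_zero 7 le_rfl]

theorem matMul_modArr (a : ℕ) (x y : Ref) : (matMul a x y).modArr = [a, 4, a] := by
  simp [matMul, forLoop, modArr]

theorem matMul_modIdx (a : ℕ) (x y : Ref) : (matMul a x y).modIdx = [2, 3, 4, 4, 3, 2] := by
  simp [matMul, forLoop, modIdx]

theorem matMul_ensures {a h : ℕ} {x y : Ref} {F : ℕ → ℕ → ℕ → ℚ} (hσ : σ.Ready n S) (ha : a < 9)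
    (ha4 : a ≠ 4) (hS : n * (h + 1) ≤ S)
    (hxy : ∀ τ, (matMul a x y).Agree σ τ →
      x.val τ * y.val τ = F (τ.idx 2) (τ.idx 3) (τ.idx 4))
    (hF : ∀ i < n, ∀ j < n, ∀ k < n, HeightLE h (F i j k)) :
    (matMul a x y).Ensures n S σ fun τ =>
      ∀ i < n, ∀ j < n, τ.num (a, i, j) = ∑ k ∈ Finset.range n, F i j k := by
  refine .forLoop₂ (fun i j τ => ∀ i' < n, ∀ j' < n, (i' < i ∨ i' = i ∧ j' < j) →
    τ.num (a, i', j') = ∑ k ∈ Finset.range n, F i' j' k) (by simp) (by simp) (by simp)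
    (by simp [modIdx, forLoop]) (by simp [modIdx, forLoop]) (fun _ _ _ _ h => h)
    (fun _ _ _ _ h => h) hσ (by simp) (fun i hi τ h i' hi' j' hj' hlt => h i' hi' j' hj' (by omega))
    ?_ (fun τ _ _ h i hi j hj => h i hi j hj (.inl hi))
  intro i hi j hj τ hτ hA hτi hτj hI
  refine .seq (.numConst hτ ha (.zero _) ?_)
  set τ₀ := τ.setNum ⟨a, 2, 3⟩ 0 with hτ₀
  have hready : τ₀.Ready n S := hτ.setNum ha (.zero _)
  have hA₀ : (matMul a x y).Agree σ τ₀ := hA.trans ⟨fun _ _ => rfl, fun b hb _ _ =>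
    Store.setNum_num_of_ne fun h => hb (by simp [forLoop, modArr, h])⟩
  have hnum₀ (i' j' : ℕ) : τ₀.num (a, i', j') = if i' = i ∧ j' = j then 0 else τ.num (a, i', j') := by
    simp [hτ₀, Store.setNum_num, Ref.addr, hτi, hτj]
  refine .forLoop (fun k ρ => ∀ i' j', ρ.num (a, i', j') =
    if i' = i ∧ j' = j then ∑ l ∈ Finset.range k, F i j l else τ.num (a, i', j'))
    (by simp) (by simp [modIdx]) (fun _ _ _ h => h) hready (by simpa using hnum₀) ?_ ?_
  · intro k hk ρ hρ hAρ hρk hIρ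
    have hρi : ρ.idx 2 = i := (hAρ.idx 2 (by simp [modIdx, forLoop])).trans hτi
    have hρj : ρ.idx 3 = j := (hAρ.idx 3 (by simp [modIdx, forLoop])).trans hτj
    have hprod : x.val ρ * y.val ρ = F i j k := by
      rw [hxy ρ (hA₀.trans (hAρ.mono ?_ ?_)), hρi, hρj, hρk]
      · simp [matMul_modIdx, forLoop, modIdx]
      · simp [matMul_modArr, forLoop, modArr]
    have hh : HeightLE h (F i j k) := hF i hi j hj k hk
    have hhS : h ≤ S := by
      have := Nat.mul_le_mul_right (h + 1) (Nat.one_le_of_lt hk)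
      omega
    refine .seq (.arith hρ (by simp) rfl (hprod ▸ hh.mono hhS) ?_)
    have hρ' : (ρ.setNum (scalar 4) (x.val ρ * y.val ρ)).Ready n S :=
      hρ.setNum (by simp) (hprod ▸ hh.mono hhS)
    have hacc : (⟨a, 2, 3⟩ : Ref).val (ρ.setNum (scalar 4) (x.val ρ * y.val ρ)) =
        ∑ l ∈ Finset.range k, F i j l := by
      simp [Ref.val, Ref.addr, Store.setNum_num, ha4, hρi, hρj, hIρ]
    have htmp : (scalar 4).val (ρ.setNum (scalar 4) (x.val ρ * y.val ρ)) = F i j k := by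
      rw [hρ'.scalar_val, Store.setNum_num, if_pos (hρ.scalar_addr 4).symm, hprod]
    refine .arith hρ' ha rfl ?_ ?_
    · rw [hacc, htmp, ← Finset.sum_range_succ]
      exact (HeightLE.sum_range (k + 1) fun l hl => hF i hi j hj l (by omega)).mono
        ((Nat.mul_le_mul_right _ hk).trans hS)
    · intro i' j'
      rw [hacc, htmp, ← Finset.sum_range_succ]
      simp only [Store.setNum_num, Ref.addr, Store.setNum_idx, hρi, hρj, Prod.mk.injEq, true_and,
        ha4, false_and, if_false, hIρ]
      split_ifs <;> rfl
  · intro ρ _ _ hIρ i' hi' j' hj' hlt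
    rw [hIρ]
    split_ifs with h'
    · rw [h'.1, h'.2]
    · exact hI i' hi' j' hj' (by omega)

/-- Array `2` becomes `B * H * Bᵀ`, where `B` is array `1` and `H` is array `0`. -/
def gramProg : Prog := seq (matMul 3 ⟨1, 2, 4⟩ ⟨0, 4, 3⟩) (matMul 2 ⟨3, 2, 4⟩ ⟨1, 3, 4⟩)

/-- A bound for the heights of the entries of `B * H * Bᵀ` if those of the entries of `B` and `H` are
at most `b` and `h`. -/
def gramHeight (n b h : ℕ) : ℕ := n * (n * (b + h + 1) + b + 1)

theorem gramProg_modArr : gramProg.modArr = [3, 4, 3, 2, 4, 2] := rfl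

theorem gramProg_modIdx : gramProg.modIdx = [2, 3, 4, 4, 3, 2, 2, 3, 4, 4, 3, 2] := rfl

/-- All entries of the `n × n` matrix in array `a` have height at most `h`. -/
def Store.MatrixHeightLE (n : ℕ) (σ : Store) (a h : ℕ) : Prop :=
  ∀ i < n, ∀ j < n, HeightLE h (σ.num (a, i, j))

theorem Store.MatrixHeightLE.of_eq {τ : Store} {a h : ℕ} (hσ : σ.MatrixHeightLE n a h)
    (hτ : ∀ i j, τ.num (a, i, j) = σ.num (a, i, j)) : τ.MatrixHeightLE n a h :=
  fun i hi j hj => hτ i j ▸ hσ i hi j hj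

theorem Store.matrix_eq_of_agree {P : Prog} {τ : Store} {a : ℕ} (h : P.Agree σ τ) (ha : a ∉ P.modArr)
    (n : ℕ) : τ.matrix a n = σ.matrix a n := by
  ext i j
  exact h.num a ha i j

theorem gramProg_ensures {b h : ℕ} (hσ : σ.Ready n S) (hB : σ.MatrixHeightLE n 1 b)
    (hH : σ.MatrixHeightLE n 0 h) (hS : gramHeight n b h ≤ S) :
    gramProg.Ensures n S σ fun τ =>
      τ.matrix 2 n = σ.matrix 1 n * σ.matrix 0 n * (σ.matrix 1 n).transpose ∧
        τ.MatrixHeightLE n 2 (gramHeight n b h) := by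
  have hS' : n * (b + h + 1) ≤ S := by
    rcases Nat.eq_zero_or_pos n with rfl | hn
    · simp
    · have := Nat.mul_le_mul_right (n * (b + h + 1) + b + 1) hn
      unfold gramHeight at hS
      omega
  refine .seq ((matMul_ensures (h := b + h)
    (F := fun i j k => σ.num (1, i, k) * σ.num (0, k, j)) hσ (by simp) (by simp) hS' (fun τ hA => ?_)
    fun i hi j hj k hk => (hB i hi k hk).mul (hH k hk j hj)).mono fun τ hτ hA hT => ?_)
  · simp only [Ref.val, Ref.addr]
    rw [hA.num 1 (by simp [matMul_modArr]), hA.num 0 (by simp [matMul_modArr])]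
  have hτ1 (i j : ℕ) : τ.num (1, i, j) = σ.num (1, i, j) := hA.num 1 (by simp [matMul_modArr]) i j
  have hT' : τ.MatrixHeightLE n 3 (n * (b + h + 1)) := fun i hi j hj => by
    rw [hT i hi j hj]
    exact .sum_range n fun k hk => (hB i hi k hk).mul (hH k hk j hj)
  have hF (i : ℕ) (hi : i < n) (j : ℕ) (hj : j < n) (k : ℕ) (hk : k < n) :
      HeightLE (n * (b + h + 1) + b) (τ.num (3, i, k) * τ.num (1, j, k)) :=
    (hT' i hi k hk).mul (hτ1 j k ▸ hB j hj k hk)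
  refine (matMul_ensures (h := n * (b + h + 1) + b)
    (F := fun i j k => τ.num (3, i, k) * τ.num (1, j, k)) hτ (by simp) (by simp) hS (fun ρ hA' => ?_)
    hF).mono fun ρ _ _ hG => ⟨?_, fun i hi j hj => ?_⟩
  · simp only [Ref.val, Ref.addr]
    rw [hA'.num 3 (by simp [matMul_modArr]), hA'.num 1 (by simp [matMul_modArr])]
  · ext i j
    change ρ.num (2, (i : ℕ), (j : ℕ)) = _
    rw [hG i i.2 j j.2, Finset.sum_range, Matrix.mul_apply]
    refine Finset.sum_congr rfl fun k _ => ?_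
    rw [hT i i.2 k k.2, hτ1, Finset.sum_range, Matrix.mul_apply]
    rfl
  · rw [hG i hi j hj]
    exact .sum_range n (hF i hi j hj)

/-! ### The search for the largest off-diagonal entry -/

/-- Data register `(5, 0, 0)` becomes the largest square of an entry of array `2` above the diagonal,
and the index registers `5` and `6` become the position of such an entry. -/
def searchProg : Prog :=
  seq (numConst (scalar 5) 0) <| forLoop 2 <| forLoop 3 <|
    ite (.idxLt 2 3)
      (seq (arith .mul (scalar 4) ⟨2, 2, 3⟩ ⟨2, 2, 3⟩) <|
        ite (.numLt (scalar 5) (scalar 4))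
          (seq (arith .mul (scalar 5) ⟨2, 2, 3⟩ ⟨2, 2, 3⟩) <| seq (idxAdd 5 2 7) (idxAdd 6 3 7))
          skip)
      skip

/-- The result of `searchProg`, for entries above the diagonal that come before `(i, j)` in
lexicographic order. -/
structure IsMaxBefore (n : ℕ) (σ : Store) (i j : ℕ) : Prop where
  nonneg : 0 ≤ σ.num (5, 0, 0)
  sq_le : ∀ i' j', (i' < i ∨ i' = i ∧ j' < j) → i' < j' → j' < n →
    σ.num (2, i', j') ^ 2 ≤ σ.num (5, 0, 0)
  attained : 0 < σ.num (5, 0, 0) → σ.idx 5 < σ.idx 6 ∧ σ.idx 6 < n ∧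
    σ.num (2, σ.idx 5, σ.idx 6) ^ 2 = σ.num (5, 0, 0)

theorem IsMaxBefore.setIdx {i j r v : ℕ} (h : IsMaxBefore n σ i j) (h5 : 5 ≠ r) (h6 : 6 ≠ r) :
    IsMaxBefore n (σ.setIdx r v) i j where
  nonneg := h.nonneg
  sq_le := h.sq_le
  attained := by simpa [h5, h6] using h.attained

theorem searchProg_modArr : searchProg.modArr = [5, 4, 5] := rfl

/-- The result at `(n, 0)` concerns all entries above the diagonal, which suffices by symmetry. -/
theorem searchProg_ensures {h : ℕ} (hσ : σ.Ready n S) (hA : σ.MatrixHeightLE n 2 h)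
    (hS : h + h ≤ S) : searchProg.Ensures n S σ fun τ => IsMaxBefore n τ n 0 := by
  refine .seq (.numConst hσ (by simp) (.zero _) ?_)
  have hσ₀ : (σ.setNum (scalar 5) 0).Ready n S := hσ.setNum (by simp) (.zero _)
  refine .forLoop₂ (fun i j τ => IsMaxBefore n τ i j) (by simp) (by simp) (by simp) (by simp [modIdx])
    (by simp [modIdx]) (fun i j τ v h => h.setIdx (by simp) (by simp))
    (fun i j τ v h => h.setIdx (by simp) (by simp)) hσ₀ ?_
    (fun i hi τ h => ⟨h.nonneg, fun i' j' hlt _ hj' => h.sq_le i' j' (by omega) ‹_› hj', h.attained⟩) ?_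
    fun τ _ _ h => h
  · have h0 : (σ.setNum (scalar 5) 0).num (5, 0, 0) = 0 := by
      simp [Store.setNum_num, hσ.scalar_addr]
    exact ⟨h0.ge, by simp, by simp [h0]⟩
  intro i hi j hj τ hτ hAg hτi hτj hI
  have hnum2 (i j : ℕ) : τ.num (2, i, j) = σ.num (2, i, j) :=
    (hAg.num 2 (by simp [forLoop, modArr]) i j).trans (Store.setNum_num_of_ne (by simp))
  refine .ite hτ (fun ht => ?_) fun ht => .skip hτ ?_
  · have hij : i < j := by simpa [Test.eval, hτi, hτj] using ht
    have hh : HeightLE S (σ.num (2, i, j) * σ.num (2, i, j)) :=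
      ((hA i hi j hj).mul (hA i hi j hj)).mono hS
    have hval : (⟨2, 2, 3⟩ : Ref).val τ = σ.num (2, i, j) := by
      simp [Ref.val, Ref.addr, hτi, hτj, hnum2]
    refine .seq (.arith (v := σ.num (2, i, j) * σ.num (2, i, j)) hτ (by simp)
      (by simp [ArithOp.eval, hval]) hh ?_)
    set τ₁ := τ.setNum (scalar 4) (σ.num (2, i, j) * σ.num (2, i, j)) with hτ₁
    have hr₁ : τ₁.Ready n S := hτ.setNum (by simp) hh
    have h4 : τ₁.num (4, 0, 0) = σ.num (2, i, j) * σ.num (2, i, j) := by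
      simp [hτ₁, Store.setNum_num, hτ.scalar_addr]
    have hne {b : ℕ} (hb : b ≠ 4) (i j : ℕ) : τ₁.num (b, i, j) = τ.num (b, i, j) :=
      Store.setNum_num_of_ne hb
    refine .ite hr₁ (fun ht' => ?_) fun ht' => .skip hr₁ ?_
    · have hlt : τ.num (5, 0, 0) < σ.num (2, i, j) * σ.num (2, i, j) := by
        simpa [Test.eval, hr₁.scalar_val, hne, h4] using ht'
      have hval₁ : (⟨2, 2, 3⟩ : Ref).val τ₁ = σ.num (2, i, j) := by
        rw [← hval]
        exact hne (by simp) _ _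
      refine .seq (.arith (v := σ.num (2, i, j) * σ.num (2, i, j)) hr₁ (by simp)
        (by simp [ArithOp.eval, hval₁]) hh ?_)
      set τ₂ := τ₁.setNum (scalar 5) (σ.num (2, i, j) * σ.num (2, i, j)) with hτ₂
      have hr₂ : τ₂.Ready n S := hr₁.setNum (by simp) hh
      have hi₂ : τ₂.idx 2 = i := hτi
      have hj₂ : τ₂.idx 3 = j := hτj
      have h7₂ : τ₂.idx 7 = 0 := hr₂.idx_eq_zero 7 le_rfl
      have h5₂ : τ₂.num (5, 0, 0) = σ.num (2, i, j) * σ.num (2, i, j) := by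
        simp [hτ₂, Store.setNum_num, hr₁.scalar_addr]
      have hn₂ (i j : ℕ) : τ₂.num (2, i, j) = σ.num (2, i, j) :=
        (Store.setNum_num_of_ne (by simp)).trans ((hne (by simp) i j).trans (hnum2 i j))
      refine .seq (.idxAdd hr₂ (by simp) (by omega) ?_)
      have hr₃ := hr₂.setIdx (r := 5) (v := τ₂.idx 2 + τ₂.idx 7) (by simp) (by simp) (by omega)
      refine .idxAdd hr₃ (by simp) (by simp [hj₂, h7₂]; omega) ⟨?_, ?_, ?_⟩
      · simp only [Store.setIdx_num, h5₂]
        exact mul_self_nonneg _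
      · intro i' j' hlt' hij' hj'
        simp only [Store.setIdx_num, h5₂, hn₂]
        by_cases heq : i' = i ∧ j' = j
        · rw [heq.1, heq.2, sq]
        · exact (hnum2 i' j' ▸ hI.sq_le i' j' (by omega) hij' hj').trans hlt.le
      · intro _
        simp [hi₂, hj₂, h7₂, h5₂, hn₂, sq, hij, hj]
    · have hle : σ.num (2, i, j) * σ.num (2, i, j) ≤ τ.num (5, 0, 0) := by
        simpa [Test.eval, hr₁.scalar_val, hne, h4] using ht'
      refine ⟨by simpa [hne] using hI.nonneg, fun i' j' hlt' hij' hj' => ?_, fun hpos => ?_⟩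
      on_goal 2 =>
        rw [hne (by simp)] at hpos ⊢
        rw [hne (by simp)]
        exact hI.attained hpos
      rw [hne (by simp), hne (by simp)]
      by_cases heq : i' = i ∧ j' = j
      · rwa [heq.1, heq.2, sq, hnum2]
      · exact hI.sq_le i' j' (by omega) hij' hj'
  · have hij : j ≤ i := by simpa [Test.eval, hτi, hτj] using ht
    exact ⟨hI.nonneg, fun i' j' hlt' hij' hj' => hI.sq_le i' j' (by omega) hij' hj', hI.attained⟩

end SymDec

namespace SymDec

open Prog

variable {n S : ℕ} {σ : Store}

/-! ### The elimination step -/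

/-- Data register `(6, 0, 0)` becomes the multiplier of the row addition, for the pivot position in
the index registers `5` and `6` and the square of the corresponding entry in `(5, 0, 0)`. -/
def signProg : Prog :=
  seq (arith .mul (scalar 4) ⟨2, 5, 5⟩ ⟨2, 5, 5⟩) <|
    ite (.numLt (scalar 4) (scalar 5))
      (seq (arith .add (scalar 4) ⟨2, 5, 5⟩ ⟨2, 6, 6⟩) <|
        seq (arith .mul (scalar 4) (scalar 4) ⟨2, 5, 6⟩) <|
          ite (.numLt (scalar 4) (scalar 9)) (numConst (scalar 6) (-1)) (numConst (scalar 6) 1))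
      (numConst (scalar 6) 0)

theorem signProg_ensures {h : ℕ} (hσ : σ.Ready n S) (hA : σ.MatrixHeightLE n 2 h)
    (hS : 3 * h + 1 ≤ S) {p q : ℕ} (hp : σ.idx 5 = p) (hq : σ.idx 6 = q) (hpn : p < n) (hqn : q < n)
    {a d x : ℚ} (ha : σ.num (2, p, p) = a) (hd : σ.num (2, q, q) = d) (hx : σ.num (2, p, q) = x)
    (hμ : x ^ 2 = σ.num (5, 0, 0)) :
    signProg.Ensures n S σ fun τ => (τ.num (6, 0, 0) = 0 ∧ |x| ≤ |a|) ∨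
      ((τ.num (6, 0, 0) = 1 ∨ τ.num (6, 0, 0) = -1) ∧ |a| ≤ |x| ∧
        0 ≤ (τ.num (6, 0, 0) * x) * (a + d)) := by
  have hha : HeightLE h a := ha ▸ hA p hpn p hpn
  have hhd : HeightLE h d := hd ▸ hA q hqn q hqn
  have hhx : HeightLE h x := hx ▸ hA p hpn q hqn
  have h6 {τ : Store} (hτ : τ.Ready n S) (v : ℚ) : (τ.setNum (scalar 6) v).num (6, 0, 0) = v := by
    rw [Store.setNum_num, if_pos (hτ.scalar_addr 6).symm]
  have hva : (⟨2, 5, 5⟩ : Ref).val σ = a := by simp [Ref.val, Ref.addr, hp, ha]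
  have h1 : HeightLE S (a * a) := (hha.mul hha).mono (by omega)
  refine .seq (.arith (v := a * a) hσ (by simp) (by simp [ArithOp.eval, hva]) h1 ?_)
  set τ₁ := σ.setNum (scalar 4) (a * a) with hτ₁
  have hr₁ : τ₁.Ready n S := hσ.setNum (by simp) h1
  have hne₁ {b : ℕ} (hb : b ≠ 4) (i j : ℕ) : τ₁.num (b, i, j) = σ.num (b, i, j) :=
    Store.setNum_num_of_ne hb
  have h4₁ : τ₁.num (4, 0, 0) = a * a := by
    rw [hτ₁, Store.setNum_num, if_pos (hσ.scalar_addr 4).symm]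
  have htest : (Test.numLt (scalar 4) (scalar 5)).eval τ₁ = decide (a ^ 2 < x ^ 2) := by
    simp only [Test.eval, hr₁.scalar_val, h4₁, hne₁ (show 5 ≠ 4 by simp), hμ, sq a]
  refine .ite hr₁ (fun ht => ?_) fun ht => ?_
  · have hax : |a| ≤ |x| := by
      rw [htest, decide_eq_true_eq] at ht
      exact (sq_lt_sq.1 ht).le
    have h2 : HeightLE S (a + d) := (hha.add hhd).mono (by omega)
    have hva₁ : (⟨2, 5, 5⟩ : Ref).val τ₁ = a := hva ▸ hne₁ (by simp) _ _
    have hvd₁ : (⟨2, 6, 6⟩ : Ref).val τ₁ = d := by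
      refine (hne₁ (by simp) _ _).trans ?_
      simp [hτ₁, hq, hd]
    refine .seq (.arith (v := a + d) hr₁ (by simp) (by simp [ArithOp.eval, hva₁, hvd₁]) h2 ?_)
    set τ₂ := τ₁.setNum (scalar 4) (a + d) with hτ₂
    have hr₂ : τ₂.Ready n S := hr₁.setNum (by simp) h2
    have h4₂ : (scalar 4).val τ₂ = a + d := by
      rw [hr₂.scalar_val, hτ₂, Store.setNum_num, if_pos (hr₁.scalar_addr 4).symm]
    have hvx₂ : (⟨2, 5, 6⟩ : Ref).val τ₂ = x := by
      refine (Store.setNum_num_of_ne (by simp)).trans ((hne₁ (by simp) _ _).trans ?_)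
      simp [hτ₂, hτ₁, hp, hq, hx]
    have h3 : HeightLE S ((a + d) * x) := ((hha.add hhd).mul hhx).mono (by omega)
    refine .seq (.arith (v := (a + d) * x) hr₂ (by simp)
      (by simp only [ArithOp.eval, h4₂, hvx₂]) h3 ?_)
    set τ₃ := τ₂.setNum (scalar 4) ((a + d) * x) with hτ₃
    have hr₃ : τ₃.Ready n S := hr₂.setNum (by simp) h3
    have h4₃ : τ₃.num (4, 0, 0) = (a + d) * x := by
      rw [hτ₃, Store.setNum_num, if_pos (hr₂.scalar_addr 4).symm]
    have htest' : (Test.numLt (scalar 4) (scalar 9)).eval τ₃ = decide ((a + d) * x < 0) := by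
      simp only [Test.eval, hr₃.scalar_val, h4₃, hr₃.arr_eq_zero 9 0 0 le_rfl]
    refine .ite hr₃ (fun ht' => ?_) fun ht' => ?_
    · rw [htest', decide_eq_true_eq] at ht'
      refine .numConst hr₃ (by simp) (HeightLE.one S).neg (.inr ?_)
      rw [h6 hr₃]
      exact ⟨.inr rfl, hax, by linarith⟩
    · rw [htest', decide_eq_false_iff_not, not_lt] at ht'
      refine .numConst hr₃ (by simp) (.one S) (.inr ?_)
      rw [h6 hr₃]
      exact ⟨.inl rfl, hax, by linarith⟩
  · rw [htest, decide_eq_false_iff_not, not_lt, sq_le_sq] at ht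
    refine .numConst hr₁ (by simp) (.zero S) (.inl ?_)
    rw [h6 hr₁]
    exact ⟨rfl, ht⟩

/-- In array `1`, `(6, 0, 0)` times row `q` is added to row `p`, where `p` and `q` are the contents of
the index registers `5` and `6`. -/
def addRowProg : Prog :=
  forLoop 4 <| seq (arith .mul (scalar 4) (scalar 6) ⟨1, 6, 4⟩) <|
    arith .add ⟨1, 5, 4⟩ ⟨1, 5, 4⟩ (scalar 4)

theorem addRowProg_ensures {b : ℕ} (hσ : σ.Ready n S) (hB : σ.MatrixHeightLE n 1 b)
    (hS : 2 * b + 1 ≤ S) {p q : ℕ} (hp : σ.idx 5 = p) (hq : σ.idx 6 = q) (hpn : p < n) (hqn : q < n)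
    (hs : HeightLE 0 (σ.num (6, 0, 0))) :
    addRowProg.Ensures n S σ fun τ => τ.MatrixHeightLE n 1 (2 * b + 1) ∧
      ∀ r < n, ∀ c < n, τ.num (1, r, c) = if r = p then
        σ.num (1, p, c) + σ.num (6, 0, 0) * σ.num (1, q, c) else σ.num (1, r, c) := by
  have hnew (c : ℕ) (hc : c < n) :
      HeightLE (2 * b + 1) (σ.num (1, p, c) + σ.num (6, 0, 0) * σ.num (1, q, c)) :=
    ((hB p hpn c hc).add (hs.mul (hB q hqn c hc))).mono (by omega)
  refine .forLoop (fun k τ => ∀ r c, τ.num (1, r, c) = if r = p ∧ c < k then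
    σ.num (1, p, c) + σ.num (6, 0, 0) * σ.num (1, q, c) else σ.num (1, r, c)) (by simp)
    (by simp [modIdx]) (fun _ _ _ h => h) hσ (by simp) ?_ ?_
  · intro k hk τ hτ hA hτk hI
    have hτp : τ.idx 5 = p := (hA.idx 5 (by simp [forLoop, modIdx])).trans hp
    have hτq : τ.idx 6 = q := (hA.idx 6 (by simp [forLoop, modIdx])).trans hq
    have hv6 : (scalar 6).val τ = σ.num (6, 0, 0) := by
      rw [hτ.scalar_val, hA.num 6 (by simp [forLoop, modArr])]
    have hvq : (⟨1, 6, 4⟩ : Ref).val τ = σ.num (1, q, k) := by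
      simp [Ref.val, Ref.addr, hτq, hτk, hI]
    have h1 : HeightLE S (σ.num (6, 0, 0) * σ.num (1, q, k)) :=
      (hs.mul (hB q hqn k hk)).mono (by omega)
    refine .seq (.arith (v := σ.num (6, 0, 0) * σ.num (1, q, k)) hτ (by simp)
      (by simp only [ArithOp.eval, hv6, hvq]) h1 ?_)
    set τ₁ := τ.setNum (scalar 4) (σ.num (6, 0, 0) * σ.num (1, q, k)) with hτ₁
    have hr₁ : τ₁.Ready n S := hτ.setNum (by simp) h1
    have hv4 : (scalar 4).val τ₁ = σ.num (6, 0, 0) * σ.num (1, q, k) := by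
      rw [hr₁.scalar_val, hτ₁, Store.setNum_num, if_pos (hτ.scalar_addr 4).symm]
    have hn₁ (i j : ℕ) : τ₁.num (1, i, j) = τ.num (1, i, j) := Store.setNum_num_of_ne (by simp)
    have hvp : (⟨1, 5, 4⟩ : Ref).val τ₁ = σ.num (1, p, k) := by
      refine (hn₁ _ _).trans ?_
      simp [hτ₁, hτp, hτk, hI]
    refine .arith (v := σ.num (1, p, k) + σ.num (6, 0, 0) * σ.num (1, q, k)) hr₁ (by simp)
      (by simp only [ArithOp.eval, hv4, hvp]) ((hnew k hk).mono hS) ?_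
    intro r c
    have hp₁ : τ₁.idx 5 = p := hτp
    have hk₁ : τ₁.idx 4 = k := hτk
    rw [Store.setNum_num, hn₁, hI]
    simp only [Ref.addr, hp₁, hk₁, Prod.mk.injEq, true_and]
    by_cases hr : r = p
    · rcases lt_trichotomy c k with hc | rfl | hc
      · simp [hr, hc, hc.ne, hc.trans (Nat.lt_succ_self k)]
      · simp [hr]
      · simp [hr, hc.ne', hc.not_gt, show ¬ c < k + 1 by omega]
    · simp [hr]
  · intro τ _ _ hI
    have hI' (r : ℕ) (c : ℕ) (hc : c < n) : τ.num (1, r, c) = if r = p then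
        σ.num (1, p, c) + σ.num (6, 0, 0) * σ.num (1, q, c) else σ.num (1, r, c) := by
      rw [hI]
      simp [hc]
    refine ⟨fun r hr c hc => ?_, fun r _ c hc => hI' r c hc⟩
    rw [hI' r c hc]
    split_ifs
    · exact hnew c hc
    · exact (hB r hr c hc).mono (by omega)

/-- The pivot row, whose number is in index register `5`, is eliminated from all other rows of
array `1`. The pivot is copied to `(8, 0, 0)` and overwritten by `0` in array `2`, so that the pivot
row itself gets the multiplier `0`. -/
def eliminateProg : Prog :=
  seq (arith .add (scalar 8) ⟨2, 5, 5⟩ (scalar 9)) <| seq (numConst ⟨2, 5, 5⟩ 0) <|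
    forLoop 2 <| seq (arith .div (scalar 7) ⟨2, 2, 5⟩ (scalar 8)) <|
      forLoop 4 <| seq (arith .mul (scalar 4) (scalar 7) ⟨1, 5, 4⟩) <|
        arith .sub ⟨1, 2, 4⟩ ⟨1, 2, 4⟩ (scalar 4)

theorem eliminateProg_ensures {b h : ℕ} (hσ : σ.Ready n S) (hB : σ.MatrixHeightLE n 1 b)
    (hA : σ.MatrixHeightLE n 2 h) (hS : 2 * b + 2 * h + 1 ≤ S) {p : ℕ} (hp : σ.idx 5 = p)
    (hpn : p < n) (hpiv : σ.num (2, p, p) ≠ 0) :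
    eliminateProg.Ensures n S σ fun τ => ∀ r < n, ∀ c < n, τ.num (1, r, c) =
      if r = p then σ.num (1, p, c) else
        σ.num (1, r, c) - σ.num (2, r, p) / σ.num (2, p, p) * σ.num (1, p, c) := by
  set m : ℕ → ℚ := fun r => if r = p then 0 else σ.num (2, r, p) / σ.num (2, p, p) with hm
  have hmh (r : ℕ) (hr : r < n) : HeightLE (2 * h) (m r) := by
    simp only [hm]
    split_ifs
    · exact .zero _
    · exact ((hA r hr p hpn).div (hA p hpn p hpn)).mono (by omega)
  have h0 : HeightLE S (σ.num (2, p, p)) := (hA p hpn p hpn).mono (by omega)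
  have hvA : (⟨2, 5, 5⟩ : Ref).val σ = σ.num (2, p, p) := by simp [Ref.val, Ref.addr, hp]
  have hv9 : (scalar 9).val σ = 0 := hσ.arr_eq_zero 9 _ _ le_rfl
  refine .seq (.arith (v := σ.num (2, p, p)) hσ (by simp)
    (by simp only [ArithOp.eval, hvA, hv9, add_zero]) h0 ?_)
  set τ₁ := σ.setNum (scalar 8) (σ.num (2, p, p)) with hτ₁
  have hr₁ : τ₁.Ready n S := hσ.setNum (by simp) h0
  refine .seq (.numConst hr₁ (by simp) (.zero S) ?_)
  set τ₂ := τ₁.setNum ⟨2, 5, 5⟩ 0 with hτ₂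
  have hr₂ : τ₂.Ready n S := hr₁.setNum (by simp) (.zero S)
  have hp₂ : τ₂.idx 5 = p := hp
  have h1₂ (i j : ℕ) : τ₂.num (1, i, j) = σ.num (1, i, j) :=
    (Store.setNum_num_of_ne (by simp)).trans (Store.setNum_num_of_ne (by simp))
  have h8₂ : τ₂.num (8, 0, 0) = σ.num (2, p, p) := by
    refine (Store.setNum_num_of_ne (by simp)).trans ?_
    rw [hτ₁, Store.setNum_num, if_pos (hσ.scalar_addr 8).symm]
  have h2₂ (r : ℕ) : τ₂.num (2, r, p) / σ.num (2, p, p) = m r := by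
    have hp₁ : τ₁.idx 5 = p := hp
    rw [hτ₂, Store.setNum_num, Store.setNum_num_of_ne (by simp)]
    simp only [Ref.addr, hp₁, Prod.mk.injEq, true_and, and_true, hm]
    split_ifs <;> simp
  suffices hmain : (forLoop 2 <| seq (arith .div (scalar 7) ⟨2, 2, 5⟩ (scalar 8)) <|
      forLoop 4 <| seq (arith .mul (scalar 4) (scalar 7) ⟨1, 5, 4⟩) <|
        arith .sub ⟨1, 2, 4⟩ ⟨1, 2, 4⟩ (scalar 4)).Ensures n S τ₂ fun τ => ∀ r c, τ.num (1, r, c) =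
          if r < n ∧ c < n then σ.num (1, r, c) - m r * σ.num (1, p, c) else σ.num (1, r, c) by
    refine hmain.mono fun τ _ _ hτ r hr c hc => ?_
    rw [hτ, if_pos ⟨hr, hc⟩]
    by_cases hrp : r = p
    · simp [hm, hrp]
    · simp [hm, hrp]
  refine .forLoop (fun i τ => ∀ r c, τ.num (1, r, c) =
    if r < i ∧ c < n then σ.num (1, r, c) - m r * σ.num (1, p, c) else σ.num (1, r, c)) (by simp)
    (by simp [forLoop, modIdx]) (fun _ _ _ h => h) hr₂ (by simpa using h1₂) ?_ fun τ _ _ h => h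
  intro i hi τ hτ hAg hτi hI
  have hτp : τ.idx 5 = p := (hAg.idx 5 (by simp [forLoop, modIdx])).trans hp₂
  have hrowp (c : ℕ) : τ.num (1, p, c) = σ.num (1, p, c) := by
    rw [hI]
    split_ifs
    · simp [hm]
    · rfl
  have hv8 : (scalar 8).val τ = σ.num (2, p, p) := by
    rw [hτ.scalar_val, hAg.num 8 (by simp [forLoop, modArr]), h8₂]
  have hv2 : (⟨2, 2, 5⟩ : Ref).val τ = τ₂.num (2, i, p) := by
    simp only [Ref.val, Ref.addr, hτi, hτp]
    exact hAg.num 2 (by simp [forLoop, modArr]) i p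
  have hmS : HeightLE S (m i) := (hmh i hi).mono (by omega)
  refine .seq (.arith (v := m i) hτ (by simp)
    (by simp only [ArithOp.eval, hv2, hv8, if_neg hpiv, h2₂]) hmS ?_)
  set ρ₀ := τ.setNum (scalar 7) (m i) with hρ₀
  have hr₀ : ρ₀.Ready n S := hτ.setNum (by simp) hmS
  have hn₀ (r c : ℕ) : ρ₀.num (1, r, c) = τ.num (1, r, c) := Store.setNum_num_of_ne (by simp)
  have h7₀ : ρ₀.num (7, 0, 0) = m i := by
    rw [hρ₀, Store.setNum_num, if_pos (hτ.scalar_addr 7).symm]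
  refine .forLoop (fun k ρ => ∀ r c, ρ.num (1, r, c) =
    if r = i ∧ c < k then σ.num (1, i, c) - m i * σ.num (1, p, c) else τ.num (1, r, c)) (by simp)
    (by simp [modIdx]) (fun _ _ _ h => h) hr₀ (by simpa using hn₀) ?_ ?_
  · intro k hk ρ hρ hAρ hρk hIρ
    have hρp : ρ.idx 5 = p := (hAρ.idx 5 (by simp [forLoop, modIdx])).trans hτp
    have hρi : ρ.idx 2 = i := (hAρ.idx 2 (by simp [forLoop, modIdx])).trans hτi
    have hv7 : (scalar 7).val ρ = m i := by
      rw [hρ.scalar_val, hAρ.num 7 (by simp [forLoop, modArr]), h7₀]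
    have hvp : (⟨1, 5, 4⟩ : Ref).val ρ = σ.num (1, p, k) := by
      simp only [Ref.val, Ref.addr, hρp, hρk, hIρ, lt_irrefl, and_false, if_false, hrowp]
    have h1 : HeightLE S (m i * σ.num (1, p, k)) :=
      ((hmh i hi).mul (hB p hpn k hk)).mono (by omega)
    refine .seq (.arith (v := m i * σ.num (1, p, k)) hρ (by simp)
      (by simp only [ArithOp.eval, hv7, hvp]) h1 ?_)
    set ρ₁ := ρ.setNum (scalar 4) (m i * σ.num (1, p, k)) with hρ₁
    have hr₁' : ρ₁.Ready n S := hρ.setNum (by simp) h1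
    have hn₁ (r c : ℕ) : ρ₁.num (1, r, c) = ρ.num (1, r, c) := Store.setNum_num_of_ne (by simp)
    have hv4 : (scalar 4).val ρ₁ = m i * σ.num (1, p, k) := by
      rw [hr₁'.scalar_val, hρ₁, Store.setNum_num, if_pos (hρ.scalar_addr 4).symm]
    have hi₁ : ρ₁.idx 2 = i := hρi
    have hk₁ : ρ₁.idx 4 = k := hρk
    have hvi : (⟨1, 2, 4⟩ : Ref).val ρ₁ = σ.num (1, i, k) := by
      simp only [Ref.val, Ref.addr, hi₁, hk₁, hn₁, hIρ, lt_irrefl, and_false, if_false, hI,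
        false_and]
    refine .arith (v := σ.num (1, i, k) - m i * σ.num (1, p, k)) hr₁' (by simp)
      (by simp only [ArithOp.eval, hv4, hvi])
      (((hB i hi k hk).sub ((hmh i hi).mul (hB p hpn k hk))).mono (by omega)) ?_
    intro r c
    rw [Store.setNum_num, hn₁, hIρ]
    simp only [Ref.addr, hi₁, hk₁, Prod.mk.injEq, true_and]
    by_cases hr : r = i
    · rcases lt_trichotomy c k with hc | rfl | hc
      · simp [hr, hc, hc.ne, hc.trans (Nat.lt_succ_self k)]
      · simp [hr]
      · simp [hr, hc.ne', hc.not_gt, show ¬ c < k + 1 by omega]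
    · simp [hr]
  · intro ρ _ _ hIρ r c
    rw [hIρ, hI]
    by_cases hr : r = i
    · simp [hr]
    · have : r < i + 1 ↔ r < i := by omega
      simp [hr, this]

end SymDec

namespace SymDec

open Prog

variable {n S : ℕ} {σ : Store} {H : Matrix (Fin n) (Fin n) ℚ}

/-! ### The algorithm -/

/-- Array `1`, which is zero at the start, becomes the identity matrix. -/
def initProg : Prog := forLoop 2 (numConst ⟨1, 2, 2⟩ 1)

/-- One pivot is chosen and eliminated, and the next candidate is searched for. -/
def pivotProg : Prog :=
  seq signProg <| seq addRowProg <| seq gramProg <| seq eliminateProg <| seq gramProg searchProg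

/-- Pivots are eliminated as long as `B * H * Bᵀ` has a nonzero entry off the diagonal. -/
def diagonalizeProg : Prog :=
  seq initProg <| seq (seq gramProg searchProg) <| loop (.numLt (scalar 9) (scalar 5)) pivotProg

/-- The whole algorithm; index register `1` serves as the constant `1`. -/
def algorithm : Prog := seq (idxConst 1 1) diagonalizeProg

/-- A bound for the heights of the entries of `B * H * Bᵀ`, also after a row addition to `B`. -/
def formHeight (H : Matrix (Fin n) (Fin n) ℚ) : ℕ :=
  gramHeight n (2 * entryHeight H + 1) (matSize H)

/-- A bound for the heights of all data registers during the run. -/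
def registerHeight (H : Matrix (Fin n) (Fin n) ℚ) : ℕ :=
  3 * formHeight H + 2 * (2 * entryHeight H + 1) + matSize H + 1

theorem gramHeight_mono {b b' : ℕ} (n : ℕ) (h : ℕ) (hb : b ≤ b') :
    gramHeight n b h ≤ gramHeight n b' h := by
  unfold gramHeight
  gcongr

theorem initProg_ensures (hσ : σ.Ready n S) (h0 : ∀ i j, σ.num (1, i, j) = 0) :
    initProg.Ensures n S σ fun τ => τ.matrix 1 n = 1 := by
  refine .forLoop (fun k τ => ∀ i j, τ.num (1, i, j) = if i = j ∧ i < k then 1 else 0) (by simp)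
    (by simp [modIdx]) (fun _ _ _ h => h) hσ (by simpa using h0) ?_ ?_
  · intro k hk τ hτ _ hτk hI
    refine .numConst hτ (by simp) (.one S) fun i j => ?_
    rw [Store.setNum_num, hI]
    simp only [Ref.addr, hτk, Prod.mk.injEq, true_and]
    by_cases hij : i = j
    · subst hij
      have : i < k + 1 ↔ i = k ∨ i < k := by omega
      by_cases hik : i = k <;> simp [this, hik]
    · have : ¬ (i = k ∧ j = k) := fun h => hij (h.1.trans h.2.symm)
      simp [hij, this]
  · intro τ _ _ hI
    ext i j
    change τ.num (1, (i : ℕ), (j : ℕ)) = _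
    rw [hI, Matrix.one_apply]
    simp [Fin.ext_iff]

/-- The loop invariant; the set of used pivots has `n - k` elements. -/
structure LoopInvariant (H : Matrix (Fin n) (Fin n) ℚ) (k : ℕ) (τ : Store) : Prop where
  exists_progress : ∃ J, J.card + k = n ∧ Progress H J (τ.matrix 1 n)
  input : τ.matrix 0 n = H
  form : τ.matrix 2 n = τ.matrix 1 n * H * (τ.matrix 1 n).transpose
  formHeightLE : τ.MatrixHeightLE n 2 (formHeight H)
  isMax : IsMaxBefore n τ n 0

theorem Progress.matrixHeightLE {J : Finset (Fin n)} (h : Progress H J (σ.matrix 1 n)) :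
    σ.MatrixHeightLE n 1 (entryHeight H) := fun i hi j hj => h.heightLE ⟨i, hi⟩ ⟨j, hj⟩

theorem matrixHeightLE_of_matrix_eq (h : σ.matrix 0 n = H) : σ.MatrixHeightLE n 0 (matSize H) :=
  fun i hi j hj => by
    have : σ.num (0, i, j) = H ⟨i, hi⟩ ⟨j, hj⟩ := by rw [← h]; rfl
    rw [this]
    exact .of_ratSize_le (ratSize_le_matSize H _ _)

theorem gramProg_searchProg_ensures {J : Finset (Fin n)} {k : ℕ}
    (hσ : σ.Ready n (registerHeight H)) (h : Progress H J (σ.matrix 1 n)) (hk : J.card + k = n)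
    (hH : σ.matrix 0 n = H) :
    (seq gramProg searchProg).Ensures n (registerHeight H) σ (LoopInvariant H k) := by
  have hmono : gramHeight n (entryHeight H) (matSize H) ≤ formHeight H :=
    gramHeight_mono _ _ (by omega)
  refine .seq ((gramProg_ensures hσ h.matrixHeightLE (matrixHeightLE_of_matrix_eq hH)
    (by unfold registerHeight; omega)).mono fun τ hτ hA ⟨hform, hheight⟩ => ?_)
  refine (searchProg_ensures hτ hheight (by unfold registerHeight; omega)).mono
    fun ρ hρ hA' hmax => ?_
  have e1 : ρ.matrix 1 n = σ.matrix 1 n :=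
    (Store.matrix_eq_of_agree hA' (by simp [searchProg_modArr]) n).trans
      (Store.matrix_eq_of_agree hA (by simp [gramProg_modArr]) n)
  have e0 : ρ.matrix 0 n = σ.matrix 0 n :=
    (Store.matrix_eq_of_agree hA' (by simp [searchProg_modArr]) n).trans
      (Store.matrix_eq_of_agree hA (by simp [gramProg_modArr]) n)
  have e2 : ρ.matrix 2 n = τ.matrix 2 n :=
    Store.matrix_eq_of_agree hA' (by simp [searchProg_modArr]) n
  refine ⟨⟨J, hk, e1 ▸ h⟩, e0.trans hH, by rw [e2, hform, e1, hH], fun i hi j hj => ?_, hmax⟩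
  rw [hA'.num 2 (by simp [searchProg_modArr])]
  exact (hheight i hi j hj).mono hmono

theorem LoopInvariant.form_apply {k : ℕ} (h : LoopInvariant H k σ) (i j : Fin n) :
    Matrix.toBilin' H (σ.matrix 1 n i) (σ.matrix 1 n j) = σ.num (2, i, j) := by
  rw [← mul_mul_transpose_apply, ← h.form]
  rfl

/-- The position found by the search, with the multiplier computed by `signProg`, is a valid choice of
the pivot. -/
theorem LoopInvariant.isPivotChoice {k : ℕ} (h : LoopInvariant H k σ) (hH : H.IsSymm)
    {p q : Fin n} (hp : σ.idx 5 = p) (hq : σ.idx 6 = q) (hpos : 0 < σ.num (5, 0, 0)) {s : ℚ}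
    (hs : (s = 0 ∧ |σ.num (2, p, q)| ≤ |σ.num (2, p, p)|) ∨
      ((s = 1 ∨ s = -1) ∧ |σ.num (2, p, p)| ≤ |σ.num (2, p, q)| ∧
        0 ≤ (s * σ.num (2, p, q)) * (σ.num (2, p, p) + σ.num (2, q, q)))) :
    IsPivotChoice (Matrix.toBilin' H) (σ.matrix 1 n) p q s := by
  have hform := h.form_apply
  obtain ⟨hlt, -, hmax⟩ := h.isMax.attained hpos
  rw [hp, hq] at hmax hlt
  have habs (r c : Fin n) (hrc : r < c) : |σ.num (2, r, c)| ≤ |σ.num (2, p, q)| := by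
    rw [← sq_le_sq, hmax]
    exact h.isMax.sq_le r c (.inl r.2) hrc c.2
  refine ⟨fun hpq => hlt.ne (congrArg _ hpq), ?_, fun r c hrc => ?_, by simpa only [hform] using hs⟩
  · rw [hform]
    intro h0
    rw [h0] at hmax
    simp [← hmax] at hpos
  · rw [hform p q]
    rcases lt_or_gt_of_ne hrc with hlt | hlt
    · rw [hform]
      exact habs r c hlt
    · rw [(toBilin'_isSymm hH).eq, hform]
      exact habs c r hlt

/-- A pass uses up one more pivot. -/
theorem pivotProg_ensures {k : ℕ} (hH : H.IsSymm) (hσ : σ.Ready n (registerHeight H))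
    (h : LoopInvariant H k σ) (hpos : 0 < σ.num (5, 0, 0)) :
    ∃ l < k, pivotProg.Ensures n (registerHeight H) σ (LoopInvariant H l) := by
  obtain ⟨J, hJ, hprog⟩ := h.exists_progress
  obtain ⟨hlt, hqn, hmax⟩ := h.isMax.attained hpos
  obtain ⟨p, hp⟩ : ∃ p : Fin n, σ.idx 5 = p := ⟨⟨_, hlt.trans hqn⟩, rfl⟩
  obtain ⟨q, hq⟩ : ∃ q : Fin n, σ.idx 6 = q := ⟨⟨_, hqn⟩, rfl⟩
  rw [hp, hq] at hmax
  set B := σ.matrix 1 n with hB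
  set β := Matrix.toBilin' H with hβ
  have hkpos : 0 < k := by
    obtain ⟨U, -, -, hP⟩ := hprog.exists_rowAdditions
    have hpJ : p ∉ J := by
      refine (hP.notMem_of_ne_zero (toBilin'_isSymm hH) (j := q) (fun hpq => ?_) fun h0 => ?_).1
      · rw [hp, hq, hpq] at hlt
        exact lt_irrefl _ hlt
      · rw [h.form_apply] at h0
        rw [← hmax, h0, sq, mul_zero] at hpos
        exact lt_irrefl _ hpos
    have := Finset.card_lt_univ_of_notMem hpJ
    rw [Fintype.card_fin] at this
    omega
  refine ⟨k - 1, by omega, ?_⟩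
  refine .seq ((signProg_ensures hσ h.formHeightLE (by unfold registerHeight; omega) hp hq p.2 q.2
    rfl rfl rfl hmax).mono fun τ hτ hAτ hs => ?_)
  set s := τ.num (6, 0, 0) with hsdef
  have hc := h.isPivotChoice hH hp hq hpos hs
  obtain ⟨J', hJ', hprog'⟩ := hprog.step hH hc
  have hs0 : HeightLE 0 s := by
    rcases hs with ⟨h0, -⟩ | ⟨h0 | h0, -⟩ <;> rw [h0]
    exacts [.zero 0, .one 0, (HeightLE.one 0).neg]
  have hτp : τ.idx 5 = p := (hAτ.idx 5 (by simp [signProg, modIdx])).trans hp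
  have hτq : τ.idx 6 = q := (hAτ.idx 6 (by simp [signProg, modIdx])).trans hq
  have hτ1 (i j : ℕ) : τ.num (1, i, j) = σ.num (1, i, j) :=
    hAτ.num 1 (by simp [signProg, modArr]) i j
  refine .seq ((addRowProg_ensures hτ (hprog.matrixHeightLE.of_eq hτ1)
    (by unfold registerHeight; omega) hτp hτq p.2 q.2 hs0).mono fun ρ hρ hAρ ⟨hρh, hρ1⟩ => ?_)
  have hρ0 : ρ.matrix 0 n = H :=
    (Store.matrix_eq_of_agree hAρ (by simp [addRowProg, forLoop, modArr]) n).trans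
      ((Store.matrix_eq_of_agree hAτ (by simp [signProg, modArr]) n).trans h.input)
  have hρp : ρ.idx 5 = p := (hAρ.idx 5 (by simp [addRowProg, forLoop, modIdx])).trans hτp
  have hrow (r : Fin n) : ρ.matrix 1 n r = if r = p then B p + s • B q else B r := by
    ext c
    refine (hρ1 r r.2 c c.2).trans ?_
    simp only [Fin.val_inj, hτ1]
    split_ifs <;> rfl
  refine .seq ((gramProg_ensures hρ hρh (matrixHeightLE_of_matrix_eq hρ0)
    (by unfold registerHeight formHeight; omega)).mono fun υ hυ hAυ ⟨hυ2, hυh⟩ => ?_)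
  have hυp : υ.idx 5 = p := (hAυ.idx 5 (by simp [gramProg_modIdx])).trans hρp
  have hυ1 (i j : ℕ) : υ.num (1, i, j) = ρ.num (1, i, j) :=
    hAυ.num 1 (by simp [gramProg_modArr]) i j
  have hform (r c : Fin n) : υ.num (2, r, c) = β (ρ.matrix 1 n r) (ρ.matrix 1 n c) := by
    rw [hβ, ← mul_mul_transpose_apply, ← hρ0, ← hυ2]
    rfl
  have hpp : υ.num (2, p, p) = β (B p + s • B q) (B p + s • B q) := by
    rw [hform, hrow, if_pos rfl]
  refine .seq ((eliminateProg_ensures hυ (hρh.of_eq hυ1) hυh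
    (by unfold registerHeight formHeight; omega) hυp p.2
    (hpp ▸ (hc.dominates (toBilin'_isSymm hH)).1)).mono fun χ hχ hAχ hχ1 => ?_)
  have hnew : χ.matrix 1 n = Matrix.of (pivotStep β p q s B) := by
    ext r c
    refine (hχ1 r r.2 c c.2).trans ?_
    have h1 (r : Fin n) : υ.num (1, (r : ℕ), (c : ℕ)) = ρ.matrix 1 n r c := hυ1 r c
    rw [h1, h1, hpp, hform, hrow, hrow, if_pos rfl]
    change _ = pivotStep β p q s B r c
    by_cases hr : r = p
    · simp [pivotStep, hr]
    · simp [pivotStep, hr, Fin.val_inj]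
      ring
  refine gramProg_searchProg_ensures hχ (hnew ▸ hprog') (by omega) ?_
  refine (Store.matrix_eq_of_agree hAχ (by simp [eliminateProg, forLoop, modArr]) n).trans
    ((Store.matrix_eq_of_agree hAυ (by simp [gramProg_modArr]) n).trans hρ0)

/-- When the search finds nothing but zeros, `B * H * Bᵀ` is diagonal. -/
theorem LoopInvariant.isSymmetricDecomposition {k : ℕ} (h : LoopInvariant H k σ) (hH : H.IsSymm)
    (hμ : σ.num (5, 0, 0) ≤ 0) : IsSymmetricDecomposition H (σ.matrix 1 n) (σ.matrix 2 n) where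
  nonsingular := h.exists_progress.choose_spec.2.isUnit_det
  diagonal := by
    have hzero (r c : Fin n) (hrc : r < c) : σ.num (2, r, c) = 0 :=
      pow_eq_zero_iff two_ne_zero |>.1 <| le_antisymm
        ((h.isMax.sq_le r c (.inl r.2) hrc c.2).trans hμ) (sq_nonneg _)
    intro r c hrc
    change σ.num (2, r, c) = 0
    rcases lt_or_gt_of_ne hrc with hlt | hlt
    · exact hzero r c hlt
    · rw [← h.form_apply, (toBilin'_isSymm hH).eq, h.form_apply]
      exact hzero c r hlt
  eq := h.form.symm

theorem diagonalizeProg_ensures (hH : H.IsSymm) (hσ : σ.Ready n (registerHeight H))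
    (hinput : σ.matrix 0 n = H) (h1 : ∀ i j, σ.num (1, i, j) = 0) :
    diagonalizeProg.Ensures n (registerHeight H) σ fun τ =>
      IsSymmetricDecomposition H (τ.matrix 1 n) (τ.matrix 2 n) ∧ ∃ J, Progress H J (τ.matrix 1 n) := by
  refine .seq ((initProg_ensures hσ h1).mono fun τ hτ hA hτ1 => ?_)
  have hτ0 : τ.matrix 0 n = H :=
    (Store.matrix_eq_of_agree hA (by simp [initProg, forLoop, modArr]) n).trans hinput
  refine .seq ((gramProg_searchProg_ensures (k := n) hτ (hτ1 ▸ Progress.init H) (by simp)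
    hτ0).mono fun ρ hρ _ hinv => ?_)
  have htest {τ : Store} (hτ : τ.Ready n (registerHeight H)) :
      (Test.numLt (scalar 9) (scalar 5)).eval τ = decide (0 < τ.num (5, 0, 0)) := by
    simp only [Test.eval, hτ.scalar_val, hτ.arr_eq_zero 9 0 0 le_rfl]
  refine .loop (LoopInvariant H) le_rfl hρ hinv (fun k τ hτ _ hI ht => ?_) fun k τ hτ _ hI ht => ?_
  · rw [htest hτ, decide_eq_true_eq] at ht
    exact pivotProg_ensures hH hτ hI ht
  · rw [htest hτ, decide_eq_false_iff_not, not_lt] at ht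
    obtain ⟨J, -, hJ⟩ := hI.exists_progress
    exact ⟨hI.isSymmetricDecomposition hH ht, J, hJ⟩

/-! ### The run on an input -/

theorem inputStore_num_eq_zero (H : Matrix (Fin n) (Fin n) ℚ) {a i j : ℕ}
    (h : ¬ (a = 0 ∧ i < n ∧ j < n)) : (inputStore H).num (a, i, j) = 0 := by
  simp only [inputStore, Finsupp.finsetSum_apply]
  refine Finset.sum_eq_zero fun r _ => Finset.sum_eq_zero fun c _ => ?_
  rw [Finsupp.single_apply, if_neg]
  rintro ⟨⟩
  exact h ⟨rfl, r.2, c.2⟩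

theorem inputStore_bounded (H : Matrix (Fin n) (Fin n) ℚ) {S : ℕ} (hS : matSize H ≤ S) :
    (inputStore H).Bounded n S where
  idx_eq_zero r hr := by
    simp [inputStore, show (0 : ℕ) ≠ r by omega]
  idx_le r := by
    simp only [inputStore, Finsupp.single_apply]
    split_ifs <;> omega
  arr_eq_zero a i j ha := inputStore_num_eq_zero H (by omega)
  row_eq_zero a i j ha := inputStore_num_eq_zero H (by omega)
  col_eq_zero a i j ha := inputStore_num_eq_zero H (by omega)
  height := by
    rintro ⟨a, i, j⟩
    by_cases h : a = 0 ∧ i < n ∧ j < n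
    · obtain ⟨rfl, hi, hj⟩ := h
      exact (matrixHeightLE_of_matrix_eq (inputStore_matrix H) i hi j hj).mono hS
    · rw [inputStore_num_eq_zero H h]
      exact .zero S

/-- The run of the algorithm: it ends after at most `algorithm.cost n` steps, it never leaves the
bounded memories, and its result is a symmetric decomposition whose first factor is bounded. -/
theorem algorithm_run (hH : H.IsSymm) : ∃ τ : Store,
    algorithm.run (inputStore H) (algorithm.cost n) = ⟨[], τ⟩ ∧
    (∀ t, (algorithm.run (inputStore H) t).store.Bounded n (registerHeight H)) ∧
    IsSymmetricDecomposition H (τ.matrix 1 n) (τ.matrix 2 n) ∧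
    ∃ J, Progress H J (τ.matrix 1 n) := by
  have hinput := inputStore_bounded H (S := registerHeight H) (by unfold registerHeight; omega)
  have hready : ((inputStore H).setIdx 1 1).Ready n (registerHeight H) :=
    { hinput.setIdx (by simp) (by omega) with
      dim := by simp [inputStore]
      one := by simp }
  obtain ⟨t, ht, τ, hreach, -, hdec, hprog⟩ := diagonalizeProg_ensures hH hready
    (inputStore_matrix H) (fun i j => inputStore_num_eq_zero H (by omega)) []
  have hrun (k : ℕ) : algorithm.run (inputStore H) (k + 2) =
      step^[k] ⟨[diagonalizeProg], (inputStore H).setIdx 1 1⟩ := rfl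
  have hend (l : ℕ) : step^[t + l] ⟨[diagonalizeProg], (inputStore H).setIdx 1 1⟩ = ⟨[], τ⟩ := by
    rw [add_comm, Function.iterate_add_apply, hreach.1]
    exact Function.iterate_fixed rfl l
  refine ⟨τ, ?_, fun k => ?_, hdec, hprog⟩
  · obtain ⟨l, hl⟩ := Nat.exists_eq_add_of_le ht
    have hcost : algorithm.cost n = t + l + 2 := by
      simp only [algorithm, cost, hl]
      omega
    rw [hcost, hrun, hend]
  · match k with
    | 0 => exact hinput
    | 1 => exact hinput
    | k + 2 =>
      rw [hrun]
      rcases le_total k t with hkt | hkt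
      · exact (hreach.2 k hkt).toBounded
      · obtain ⟨l, rfl⟩ := Nat.exists_eq_add_of_le hkt
        rw [hend]
        exact hreach.ready_right.toBounded

theorem algorithm_outputs (hH : H.IsSymm) : ∃ B D, algorithm.Outputs H B D ∧
    IsSymmetricDecomposition H B D ∧ ∃ J, Progress H J B := by
  obtain ⟨τ, hrun, -, hdec, hprog⟩ := algorithm_run hH
  exact ⟨_, _, ⟨algorithm.cost n, by rw [HaltsBy, hrun], by rw [hrun], by rw [hrun]⟩, hdec, hprog⟩

theorem algorithm_polyTime :
    algorithm.PolyTimeArithmeticOn fun n => {H : Matrix (Fin n) (Fin n) ℚ | H.IsSymm} := by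
  obtain ⟨T, hT⟩ := algorithm.exists_polynomial_cost
  refine ⟨T, fun n H hH => ?_⟩
  obtain ⟨τ, hrun, -⟩ := algorithm_run hH
  rw [hT, HaltsBy, hrun]

theorem algorithm_polySpace :
    algorithm.PolySpaceOn fun n => {H : Matrix (Fin n) (Fin n) ℚ | H.IsSymm} := by
  let X : Polynomial ℕ := .X
  let E : Polynomial ℕ := 2 * (6 * X ^ 2 + 5 * X) + 1
  let R : Polynomial ℕ := 3 * (X * (X * (E + X + 1) + E + 1)) + 2 * E + X + 1
  refine ⟨7 * (X + 8) + 9 * (X + 2) ^ 2 * (2 * X + 2 * R + 14), fun n H hH t => ?_⟩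
  obtain ⟨τ, -, hbounded, -⟩ := algorithm_run hH
  refine (hbounded t).space_le.trans ?_
  simp only [X, E, R, Polynomial.eval_add, Polynomial.eval_mul, Polynomial.eval_pow,
    Polynomial.eval_X, Polynomial.eval_ofNat, Polynomial.eval_one, registerHeight, formHeight,
    gramHeight, entryHeight]
  have hn := le_matSize H
  gcongr

end SymDec

theorem theorem3 :
    ∃ P : SymDec.Prog,
      P.StronglyPolynomialOn
          (fun n => {H : Matrix (Fin n) (Fin n) ℚ | H.IsSymm}) ∧
        ∀ (n : ℕ) (H : Matrix (Fin n) (Fin n) ℚ), H.IsSymm →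
          ∃ B D : Matrix (Fin n) (Fin n) ℚ,
            P.Outputs H B D ∧
            SymDec.IsSymmetricDecomposition H B D ∧
            SymDec.frobeniusNorm B ≤ (5 * (n : ℝ)) ^ ((n : ℝ) / 2) ∧
            SymDec.frobeniusNorm B⁻¹ ≤ (5 * (n : ℝ)) ^ ((n : ℝ) / 2) := by
  refine ⟨SymDec.algorithm, ⟨SymDec.algorithm_polySpace, SymDec.algorithm_polyTime⟩,
    fun n H hH => ?_⟩
  obtain ⟨B, D, hout, hdec, J, hJ⟩ := SymDec.algorithm_outputs hH
  exact ⟨B, D, hout, hdec, hJ.frobeniusNorm_le⟩
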